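/- Let $k\ge 3$ and $N\ge 4$ be integers, let $0<\delta<\tfrac14$, and let $f\in C^k[N,2N]$ be real-valued such that, for some $\lambda_k>0$ and $c_k\ge 1$, $\lambda_k\le |f^{(k)}(x)|\le c_k\lambda_k$ for all $x\in[N,2N]$. Write $\lfloor x\rceil$ for the nearest integer to $x$, $\|x\|=|x-\lfloor x\rceil|$, $\mathcal S=\{n\in[N,2N]\cap\mathbb Z:\|f(n)\|<\delta\}$, and $$a_k=36e^{-2}k(2e^3)^kc_k,\qquad b_k=20e^3k^2c_k^{\frac{2}{k(k-1)}}.$$ A *major arc* is a maximal set $\mathcal A$ of consecutive points of $\mathcal S$, with at least $k+1$ elements, such that $\lfloor f(n)\rceil=P(n)$ for all $n\in\mathcal A$, where $P\in\mathbb Q[X]$ has degree $<k$ (so $P$ is determined by $\mathcal A$). Its *denominator* $q$ is the smallest positive integer with $P\in\frac1q\mathbb Z[X]$. Among the connected components of $\{(x,y): x\in[N,2N],\ |y-f(x)|<\delta,\ y=P(x)\}$ choose one containing the largest number $l$ of points $(n,\lfloor f(n)\rceil)$, $n\in\mathcal A$; if $l>k$, the set $\bar{\mathcal A}$ of these $n$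 is the *proper major arc* extracted from $\mathcal A$, and its *length* is $L=\max\bar{\mathcal A}-\min\bar{\mathcal A}$. (If several components contain the largest number of points, fix any choice of one of them for each $\mathcal A$.) Let $R_0$ be the number of points of $\mathcal S$ that lie in at least one major arc. 1. Suppose that to each major arc $\mathcal A_j$ which has a proper major arc $\bar{\mathcal A}_j$ and whose denominator satisfies $q_j\le(a_k\delta)^{-1}$ one can assign an interval of length $L_j(a_kq_j\delta)^{-1/k}$ containing $\bar{\mathcal A}_j$, where $L_j$ is the length of $\bar{\mathcal A}_j$, in such a way that the intervals assigned to different major arcs are disjoint. Then $$R_0\le b_kN\delta^{\frac{2}{k(k-1)}}+8k^3\Big(\frac{\delta}{\lambda_k}\Big)^{1/k}+10e^3k^2 .$$ 2. Otherwise $$R_0\le \tfrac32\, b_kN\delta^{\frac{2}{k(k-1)}}+16k^3\Big(\frac{\delta}{\lambda_k}\Big)^{1/k}+10e^3k^2 .$$ -/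

import Mathlib

namespace MajorArcs

open Polynomial

/-- `S(f, N, δ)`: the integers `n ∈ [N, 2N]` with `‖f n‖ < δ`, where `‖·‖` is the distance to the
nearest integer. -/
noncomputable def S (f : ℝ → ℝ) (N : ℕ) (δ : ℝ) : Finset ℤ :=
  open Classical in
  (Finset.Icc (N : ℤ) (2 * (N : ℤ))).filter (fun n : ℤ => |f n - round (f n)| < δ)

/-- `A` is a set of consecutive points of `S(f, N, δ)`. -/
def IsConsecutive (f : ℝ → ℝ) (N : ℕ) (δ : ℝ) (A : Finset ℤ) : Prop :=
  A ⊆ S f N δ ∧ ∀ a ∈ A, ∀ b ∈ A, ∀ n ∈ S f N δ, a ≤ n → n ≤ b → n ∈ A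

/-- All the points `(n, ⌊f n⌉)`, `n ∈ A`, lie on the curve `y = P x`. -/
def LiesOn (f : ℝ → ℝ) (A : Finset ℤ) (P : ℚ[X]) : Prop :=
  ∀ n ∈ A, ((round (f n) : ℤ) : ℚ) = P.eval (n : ℚ)

/-- `A` is a major arc associated to the `k`-th derivative of `f`, with equation `y = P x`: a
maximal set of at least `k + 1` consecutive points of `S(f, N, δ)` lying on `y = P x`, where `P`
has degree `< k` (so that `P` is the Lagrange polynomial through the points of `A`). -/
structure IsMajorArc (k : ℕ) (f : ℝ → ℝ) (N : ℕ) (δ : ℝ) (A : Finset ℤ) (P : ℚ[X]) : Prop where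
  consecutive : IsConsecutive f N δ A
  card_ge : k + 1 ≤ A.card
  degree_lt : P.degree < (k : WithBot ℕ)
  liesOn : LiesOn f A P
  maximal : ∀ B : Finset ℤ, IsConsecutive f N δ B → LiesOn f B P → A ⊆ B → B = A

/-- The smallest positive integer `q` with `P ∈ (1/q) ℤ[X]`. -/
noncomputable def denominator (P : ℚ[X]) : ℕ :=
  sInf {q : ℕ | 0 < q ∧ ∃ R : ℤ[X], R.map (Int.castRingHom ℚ) = C (q : ℚ) * P}

/-- The set `C_δ ∩ C_P` of the points of the curve `y = P x`, `x ∈ [N, 2N]`, at vertical distance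
`< δ` from the graph of `f`. -/
def tube (f : ℝ → ℝ) (N : ℕ) (δ : ℝ) (P : ℚ[X]) : Set (ℝ × ℝ) :=
  {p | p.1 ∈ Set.Icc (N : ℝ) (2 * (N : ℝ)) ∧ |p.2 - f p.1| < δ} ∩ {p | p.2 = aeval p.1 P}

/-- The `n ∈ A` for which `(n, ⌊f n⌉)` is in the connected component of `C_δ ∩ C_P`
containing `x`. -/
noncomputable def pointsInComponent (f : ℝ → ℝ) (N : ℕ) (δ : ℝ) (A : Finset ℤ) (P : ℚ[X])
    (x : ℝ × ℝ) : Finset ℤ :=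
  open Classical in
  A.filter (fun n : ℤ => ((n : ℝ), (round (f n) : ℝ)) ∈ connectedComponentIn (tube f N δ P) x)

/-- `B` is a proper major arc extracted from the major arc `A` with equation `y = P x`: the set of
the points of `A` in a connected component of `C_δ ∩ C_P` that contains the largest number of
them, this number being greater than `k`. -/
def IsProperMajorArc (k : ℕ) (f : ℝ → ℝ) (N : ℕ) (δ : ℝ) (A : Finset ℤ) (P : ℚ[X])
    (B : Finset ℤ) : Prop :=
  IsMajorArc k f N δ A P ∧ k < B.card ∧
    ∃ x ∈ tube f N δ P, B = pointsInComponent f N δ A P x ∧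
      ∀ y ∈ tube f N δ P, (pointsInComponent f N δ A P y).card ≤ B.card

/-- The length of a finite set of integers: its last element minus its first one. -/
def length (B : Finset ℤ) : ℤ :=
  if h : B.Nonempty then B.max' h - B.min' h else 0

/-- `a_k = 36 e⁻² k (2e³)^k c_k`. -/
noncomputable def aConst (k : ℕ) (c : ℝ) : ℝ :=
  36 * Real.exp (-2) * k * (2 * Real.exp 3) ^ k * c

/-- `b_k = 20 e³ k² c_k^{2/(k(k-1))}`. -/
noncomputable def bConst (k : ℕ) (c : ℝ) : ℝ :=
  20 * Real.exp 3 * (k : ℝ) ^ 2 * c ^ ((2 : ℝ) / ((k : ℝ) * ((k : ℝ) - 1)))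

/-- `σ` selects one proper major arc `σ A` from every major arc `A` from which one can be
extracted. -/
def IsSelection (k : ℕ) (f : ℝ → ℝ) (N : ℕ) (δ : ℝ) (σ : Finset ℤ → Finset ℤ) : Prop :=
  ∀ (A : Finset ℤ) (P : ℚ[X]),
    (∃ B, IsProperMajorArc k f N δ A P B) → IsProperMajorArc k f N δ A P (σ A)

/-- `I` is an interval (open, closed or half-open) of length `d`. -/
def IsIntervalOfLength (I : Set ℝ) (d : ℝ) : Prop :=
  ∃ u : ℝ, Set.Ioo u (u + d) ⊆ I ∧ I ⊆ Set.Icc u (u + d)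

/-- The major arc `A`, with equation `y = P x`, has the (selected) proper major arc `σ A`, and its
denominator is at most `(a_k δ)⁻¹`. -/
def IsSmallArc (k : ℕ) (f : ℝ → ℝ) (N : ℕ) (δ c : ℝ) (σ : Finset ℤ → Finset ℤ)
    (A : Finset ℤ) (P : ℚ[X]) : Prop :=
  IsProperMajorArc k f N δ A P (σ A) ∧ (denominator P : ℝ) ≤ (aConst k c * δ)⁻¹

/-- Every proper major arc of denominator `q ≤ (a_k δ)⁻¹` and length `L` can be covered with an
interval of length `L (a_k q δ)^{-1/k}`, in such a way that the intervals which belong to different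
major arcs are disjoint. -/
def HasDisjointCovers (k : ℕ) (f : ℝ → ℝ) (N : ℕ) (δ c : ℝ) (σ : Finset ℤ → Finset ℤ) : Prop :=
  ∃ I : Finset ℤ → Set ℝ,
    (∀ (A : Finset ℤ) (P : ℚ[X]), IsSmallArc k f N δ c σ A P →
      IsIntervalOfLength (I A)
        ((length (σ A) : ℝ) * (aConst k c * (denominator P : ℝ) * δ) ^ (-(1 : ℝ) / (k : ℝ))) ∧
      ∀ n ∈ σ A, (n : ℝ) ∈ I A) ∧
    ∀ (A A' : Finset ℤ) (P P' : ℚ[X]), IsSmallArc k f N δ c σ A P →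
      IsSmallArc k f N δ c σ A' P' → A ≠ A' → Disjoint (I A) (I A')

/-- `R₀`: the number of points of `S(f, N, δ)` that lie in some major arc. -/
noncomputable def R₀ (k : ℕ) (f : ℝ → ℝ) (N : ℕ) (δ : ℝ) : ℕ :=
  open Classical in
  ((S f N δ).filter (fun n : ℤ => ∃ (A : Finset ℤ) (P : ℚ[X]), IsMajorArc k f N δ A P ∧ n ∈ A)).card

end MajorArcs

namespace MajorArcs

open Polynomial

/-! One estimate serves both parts. Put `n = k(k-1)/2` and `Y = 6c(k+1)δ`, and cut `[N, 2N]` into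
windows of length `Y^(-1/n)`. Since arcs are sets of consecutive points, if every arc has at most
`k` points in a window, then the arcs together have at most `2k` there: each sticks out to the left
or to the right, and on each side a single arc contains all the points concerned.

Otherwise some arc, with equation `P` and denominator `q`, has `k + 1` points in the window.
Clearing denominators in Newton interpolation gives `q ≤ Y⁻¹`. Divided differences bound `λ` from
above, then `f - P` at every other point of `S` in the window, so tightly that `⌊f⌉ - P`, a multiple
of `1/q`, vanishes. By maximality all these points belong to the arc (`IsMajorArc.window_subset`).

If this arc has at most `2k²` points, the window is paid for. The longer arcs with `Yq ≤ 1` are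
counted globally: such an arc owns an interval, starting at its `k`-th point, whose length is at
least a multiple of its cardinality and in which every point of `S` is its own
(`IsMajorArc.exists_isolated`). Two arcs whose intervals overlapped would share `k` points, hence
coincide. Only the last interval can leave `[N, 2N]`; its arc gives the term in `(δ/λ)^(1/k)`. -/

/-! ### Divided differences -/

theorem exists_zero_of_iterated_rolle {a b : ℝ} (k : ℕ) :
    ∀ (G : ℕ → ℝ → ℝ) (T : Finset ℝ),
      (∀ j < k, ∀ x ∈ Set.Icc a b, HasDerivWithinAt (G j) (G (j + 1) x) (Set.Icc a b) x) →
      T.card = k + 1 → (∀ x ∈ T, x ∈ Set.Icc a b) → (∀ x ∈ T, G 0 x = 0) →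
      ∃ ξ ∈ Set.Icc a b, G k ξ = 0 := by
  induction k with
  | zero =>
    intro G T _ hcard hT hz
    obtain ⟨x, hx⟩ := Finset.card_pos.1 (by omega : 0 < T.card)
    exact ⟨x, hT x hx, hz x hx⟩
  | succ k ih =>
    intro G T hG hcard hT hz
    have hmem : ∀ i, T.orderEmbOfFin hcard i ∈ T := fun i => T.orderEmbOfFin_mem hcard i
    have hroot : ∀ i : Fin (k + 1), ∃ c ∈ Set.Ioo (T.orderEmbOfFin hcard i.castSucc)
        (T.orderEmbOfFin hcard i.succ), G 1 c = 0 := by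
      intro i
      have h1 := hT _ (hmem i.castSucc)
      have h2 := hT _ (hmem i.succ)
      refine exists_hasDerivAt_eq_zero (f := G 0) ?_ ?_ ?_ ?_
      · exact (T.orderEmbOfFin hcard).strictMono (Fin.castSucc_lt_succ)
      · intro x hx
        have hx' : x ∈ Set.Icc a b := ⟨h1.1.trans hx.1, hx.2.trans h2.2⟩
        exact ((hG 0 (by omega) x hx').continuousWithinAt).mono
          (Set.Icc_subset_Icc h1.1 h2.2)
      · rw [hz _ (hmem _), hz _ (hmem _)]
      · intro x hx
        have hx' : x ∈ Set.Ioo a b := ⟨h1.1.trans_lt hx.1, hx.2.trans_le h2.2⟩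
        exact (hG 0 (by omega) x ⟨hx'.1.le, hx'.2.le⟩).hasDerivAt (Icc_mem_nhds hx'.1 hx'.2)
    choose r hr hr0 using hroot
    have hmono : StrictMono r := by
      intro i j hij
      refine (hr i).2.trans_le (le_trans ?_ (hr j).1.le)
      exact (T.orderEmbOfFin hcard).monotone (by
        rw [Fin.le_def]; simp only [Fin.val_succ, Fin.val_castSucc]; exact hij)
    refine ih (fun j => G (j + 1)) (Finset.univ.map ⟨r, hmono.injective⟩) ?_ ?_ ?_ ?_
    · intro j hj x hx
      exact hG (j + 1) (by omega) x hx
    · simp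
    · intro x hx
      obtain ⟨i, -, rfl⟩ := Finset.mem_map.1 hx
      exact ⟨(hT _ (hmem i.castSucc)).1.trans (hr i).1.le,
        (hr i).2.le.trans (hT _ (hmem i.succ)).2⟩
    · intro x hx
      obtain ⟨i, -, rfl⟩ := Finset.mem_map.1 hx
      exact hr0 i

/-- The mean value theorem for divided differences. -/
theorem exists_sum_div_eq_iteratedDerivWithin {a b : ℝ} (hab : a < b) {k : ℕ} {f : ℝ → ℝ}
    (hf : ContDiffOn ℝ k f (Set.Icc a b)) {T : Finset ℝ} (hcard : T.card = k + 1)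
    (hT : ∀ x ∈ T, x ∈ Set.Icc a b) :
    ∃ ξ ∈ Set.Icc a b, ∑ i ∈ T, f i / ∏ j ∈ T.erase i, (i - j) =
      iteratedDerivWithin k f (Set.Icc a b) ξ / (k.factorial : ℝ) := by
  classical
  have hinj : Set.InjOn (id : ℝ → ℝ) (T : Set ℝ) := Function.injective_id.injOn
  set Q : ℝ[X] := Lagrange.interpolate T id f with hQ
  have hdeg : Q.degree < T.card := Lagrange.degree_interpolate_lt _ hinj
  have heval : ∀ x ∈ T, Q.eval x = f x := fun x hx => by
    exact Lagrange.eval_interpolate_at_node (v := id) f hinj hx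
  have hu := uniqueDiffOn_Icc hab
  -- Rolle is applied to `f` minus its interpolant `Q`. The `k`-th derivative of `Q` is the constant
  -- `k!` times its coefficient of degree `k`, which is the divided difference.
  obtain ⟨ξ, hξ, h0⟩ := exists_zero_of_iterated_rolle (a := a) (b := b) k
    (fun j x => iteratedDerivWithin j f (Set.Icc a b) x - (derivative^[j] Q).eval x) T
    (by
      intro j hj x hx
      refine HasDerivWithinAt.sub ?_ ?_
      · have h := (hf.differentiableOn_iteratedDerivWithin (m := j) (by exact_mod_cast hj) hu x
          hx).hasDerivWithinAt
        rwa [← iteratedDerivWithin_succ] at h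
      · rw [Function.iterate_succ_apply']
        exact (Polynomial.hasDerivAt _ x).hasDerivWithinAt)
    hcard hT (by
      intro x hx
      simp [iteratedDerivWithin_zero, heval x hx])
  refine ⟨ξ, hξ, ?_⟩
  have hsum : Q.coeff k = ∑ i ∈ T, f i / ∏ j ∈ T.erase i, (i - j) := by
    have := Lagrange.coeff_eq_sum (v := id) (s := T) hinj (P := Q) hdeg
    rw [hcard] at this
    simp only [Nat.add_sub_cancel, id] at this
    rw [this]
    exact Finset.sum_congr rfl fun i hi => by rw [heval i hi]
  have hder : (derivative^[k] Q).eval ξ = k.factorial * Q.coeff k := by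
    have hnd : (derivative^[k] Q).natDegree ≤ 0 := by
      refine (Polynomial.natDegree_iterate_derivative Q k).trans ?_
      have : Q.natDegree ≤ k := by
        rw [Polynomial.natDegree_le_iff_coeff_eq_zero]
        rw [hcard] at hdeg
        exact fun m hm => (Polynomial.degree_lt_iff_coeff_zero Q _).1 hdeg m hm
      omega
    rw [Polynomial.eq_C_of_natDegree_le_zero hnd, eval_C, Polynomial.coeff_iterate_derivative]
    simp [Nat.descFactorial_self]
  rw [← hsum, eq_div_iff (by positivity), mul_comm, ← hder]
  linarith

/-- A divided difference of order `k` kills polynomials of degree `< k`, so `f` may be replaced by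
`f - P`, which is small on an arc. -/
theorem exists_sum_sub_div_eq_iteratedDerivWithin {a b : ℝ} (hab : a < b) {k : ℕ} {f : ℝ → ℝ}
    (hf : ContDiffOn ℝ k f (Set.Icc a b)) {P : ℚ[X]} (hP : P.degree < (k : WithBot ℕ))
    {U : Finset ℤ} (hcard : U.card = k + 1) (hU : ∀ n ∈ U, (n : ℝ) ∈ Set.Icc a b) :
    ∃ ξ ∈ Set.Icc a b, ∑ i ∈ U, (f i - aeval (i : ℝ) P) / ∏ j ∈ U.erase i, ((i : ℝ) - j) =
      iteratedDerivWithin k f (Set.Icc a b) ξ / (k.factorial : ℝ) := by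
  classical
  have hinj : Function.Injective (fun n : ℤ => (n : ℝ)) := Int.cast_injective
  obtain ⟨ξ, hξ, h⟩ := exists_sum_div_eq_iteratedDerivWithin hab hf
    (T := U.image (fun n : ℤ => (n : ℝ))) (by rw [Finset.card_image_of_injective _ hinj, hcard])
    (by
      intro x hx
      obtain ⟨n, hn, rfl⟩ := Finset.mem_image.1 hx
      exact hU n hn)
  refine ⟨ξ, hξ, ?_⟩
  rw [← h, Finset.sum_image hinj.injOn]
  have hprod : ∀ i : ℤ, ∏ j ∈ (U.image (fun n : ℤ => (n : ℝ))).erase (i : ℝ), ((i : ℝ) - j) =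
      ∏ j ∈ U.erase i, ((i : ℝ) - j) := by
    intro i
    rw [← Finset.image_erase hinj, Finset.prod_image hinj.injOn]
  simp only [hprod, sub_div, Finset.sum_sub_distrib]
  rw [sub_eq_self]
  have hQ : (P.map (algebraMap ℚ ℝ)).degree < U.card := by
    rw [Polynomial.degree_map, hcard]
    exact hP.trans (by exact_mod_cast Nat.lt_succ_self k)
  have h0 := Lagrange.coeff_eq_sum (v := fun n : ℤ => (n : ℝ)) (s := U) hinj.injOn hQ
  rw [hcard, Nat.add_sub_cancel, Polynomial.coeff_map, Polynomial.coeff_eq_zero_of_degree_lt hP,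
    map_zero] at h0
  rw [h0]
  exact Finset.sum_congr rfl fun i _ => by rw [eval_map_algebraMap]

/-! ### Denominators of polynomials integral on a finite set -/

/-- `v` clears the denominators of the polynomials of degree `< #T` that are integral on `T`. -/
def Clears (T : Finset ℤ) (v : ℕ) : Prop :=
  ∀ P : ℚ[X], P.degree < (T.card : WithBot ℕ) → (∀ n ∈ T, ∃ y : ℤ, P.eval (n : ℚ) = y) →
    ∃ R : ℤ[X], R.map (Int.castRingHom ℚ) = C (v : ℚ) * P

/-- One step of Newton interpolation: subtracting `t` times the nodal polynomial of `T` lowers the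
degree without changing the values on `T`. The value at `i` then controls the denominator of `t`. -/
theorem Clears.insert {T : Finset ℤ} {v : ℕ} (hv : Clears T v) {i : ℤ} (hi : i ∉ T) :
    Clears (insert i T) (v * ∏ j ∈ T, (i - j).natAbs) := by
  classical
  intro P hP hint
  rw [Finset.card_insert_of_notMem hi] at hP
  set Z : ℤ[X] := Lagrange.nodal T id with hZ
  set t : ℚ := P.coeff T.card with ht
  have hZmap : (Z.map (Int.castRingHom ℚ)) = Lagrange.nodal T (fun n : ℤ => (n : ℚ)) := by
    simp [hZ, Lagrange.nodal, Polynomial.map_prod]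
  have hZeval : ∀ n : ℤ, (Z.map (Int.castRingHom ℚ)).eval (n : ℚ) = ((∏ j ∈ T, (n - j) : ℤ) : ℚ) := by
    intro n
    rw [hZmap, Lagrange.eval_nodal]
    push_cast
    rfl
  have hZdeg : (Z.map (Int.castRingHom ℚ)).natDegree = T.card := by
    rw [hZmap, Lagrange.natDegree_nodal]
  have hZmonic : (Z.map (Int.castRingHom ℚ)).Monic := by
    rw [hZmap]; exact Lagrange.nodal_monic
  set Q : ℚ[X] := P - C t * Z.map (Int.castRingHom ℚ) with hQ
  have hQdeg : Q.degree < (T.card : WithBot ℕ) := by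
    rw [Polynomial.degree_lt_iff_coeff_zero]
    intro m hm
    rcases hm.eq_or_lt with rfl | hm
    · have : (Z.map (Int.castRingHom ℚ)).coeff T.card = 1 := by
        rw [← hZdeg]; exact hZmonic
      rw [hQ, coeff_sub, coeff_C_mul, this, mul_one, ht, sub_self]
    · rw [hQ, coeff_sub, coeff_C_mul,
        Polynomial.coeff_eq_zero_of_natDegree_lt (p := Z.map _) (by rw [hZdeg]; exact hm),
        (Polynomial.degree_lt_iff_coeff_zero P _).1 hP m hm, mul_zero, sub_zero]
  have hQint : ∀ n ∈ T, ∃ y : ℤ, Q.eval (n : ℚ) = y := by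
    intro n hn
    obtain ⟨y, hy⟩ := hint n (Finset.mem_insert_of_mem hn)
    refine ⟨y, ?_⟩
    rw [hQ, eval_sub, eval_mul, hZeval, Finset.prod_eq_zero hn (sub_self n), hy]
    simp
  obtain ⟨R, hR⟩ := hv Q hQdeg hQint
  obtain ⟨y, hy⟩ := hint i (Finset.mem_insert_self i T)
  set e : ℤ := ∏ j ∈ T, (i - j) with he
  have hte : (v : ℚ) * t * e = ((v * y - R.eval i : ℤ) : ℚ) := by
    have h1 : ((R.eval i : ℤ) : ℚ) = v * Q.eval (i : ℚ) := by
      have := congrArg (fun p => p.eval (i : ℚ)) hR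
      simp only [eval_mul, eval_C] at this
      rw [← this, eval_intCast_map]
      simp
    push_cast
    rw [h1, hQ, eval_sub, eval_mul, eval_C, hZeval, hy]
    ring
  have hmain : (C e * R + C (v * y - R.eval i) * Z).map (Int.castRingHom ℚ) =
      C ((v : ℚ) * e) * P := by
    have hPQ : P = Q + C t * Z.map (Int.castRingHom ℚ) := by rw [hQ]; ring
    simp only [Polynomial.map_add, Polynomial.map_mul, map_C, hR, Int.coe_castRingHom]
    rw [← hte, hPQ]
    simp only [C_mul]
    ring
  have habs : (∏ j ∈ T, (i - j).natAbs) = e.natAbs := by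
    rw [he]; exact (map_prod Int.natAbsHom _ _).symm
  rw [habs]
  rcases Int.natAbs_eq e with h | h
  · refine ⟨_, hmain.trans ?_⟩
    rw [h]; push_cast; simp
  · refine ⟨-(C e * R + C (v * y - R.eval i) * Z), ?_⟩
    rw [Polynomial.map_neg, hmain]
    have : (e : ℚ) = -(e.natAbs : ℚ) := by
      have := congrArg (fun z : ℤ => (z : ℚ)) h
      simpa using this
    rw [this]; push_cast; simp

theorem exists_clears (M : ℕ) : ∀ T : Finset ℤ,
    (∀ a ∈ T, ∀ b ∈ T, (a - b).natAbs ≤ M) →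
    ∃ v : ℕ, 0 < v ∧ v ≤ M ^ (T.card * (T.card - 1) / 2) ∧ Clears T v := by
  classical
  intro T
  induction T using Finset.induction_on with
  | empty =>
    intro _
    refine ⟨1, one_pos, by simp, fun P hP _ => ⟨0, ?_⟩⟩
    have : P = 0 := by
      rw [← Polynomial.degree_eq_bot]
      simpa using hP
    simp [this]
  | insert i T hi ih =>
    intro hM
    obtain ⟨v, hv0, hv, hcl⟩ := ih fun a ha b hb =>
      hM a (Finset.mem_insert_of_mem ha) b (Finset.mem_insert_of_mem hb)
    refine ⟨_, ?_, ?_, hcl.insert hi⟩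
    · refine Nat.mul_pos hv0 (Finset.prod_pos fun j hj => ?_)
      rw [Int.natAbs_pos, sub_ne_zero]
      rintro rfl
      exact hi hj
    · rw [Finset.card_insert_of_notMem hi]
      have h1 : ∏ j ∈ T, (i - j).natAbs ≤ M ^ T.card :=
        Finset.prod_le_pow_card _ _ _ fun j hj =>
          hM i (Finset.mem_insert_self i T) j (Finset.mem_insert_of_mem hj)
      have h2 : (T.card + 1) * (T.card + 1 - 1) / 2 = T.card * (T.card - 1) / 2 + T.card := by
        rw [← Finset.sum_range_id, ← Finset.sum_range_id, Finset.sum_range_succ]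
      rw [h2, pow_add]
      exact Nat.mul_le_mul hv h1

theorem denominator_le {P : ℚ[X]} {T : Finset ℤ} {v : ℕ}
    (hP : P.degree < (T.card : WithBot ℕ)) (hint : ∀ n ∈ T, ∃ y : ℤ, P.eval (n : ℚ) = y)
    (hv : 0 < v) (hcl : Clears T v) : denominator P ≤ v :=
  Nat.sInf_le ⟨hv, hcl P hP hint⟩

/-- The set defining `denominator P` is nonempty, so its `sInf` is attained instead of being the
default value `0`. -/
theorem denominator_spec {P : ℚ[X]} {T : Finset ℤ}
    (hP : P.degree < (T.card : WithBot ℕ)) (hint : ∀ n ∈ T, ∃ y : ℤ, P.eval (n : ℚ) = y) :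
    0 < denominator P ∧ ∃ R : ℤ[X], R.map (Int.castRingHom ℚ) = C (denominator P : ℚ) * P := by
  obtain ⟨v, hv, -, hcl⟩ := exists_clears (T.sup fun a => T.sup fun b => (a - b).natAbs) T
    fun a ha b hb => (Finset.le_sup (f := fun b => (a - b).natAbs) hb).trans
      (Finset.le_sup (f := fun a => T.sup fun b => (a - b).natAbs) ha)
  exact Nat.sInf_mem (s := {q : ℕ | 0 < q ∧ ∃ R : ℤ[X], R.map (Int.castRingHom ℚ) = C (q : ℚ) * P})
    ⟨v, hv, hcl P hP hint⟩

theorem denominator_le_pow {P : ℚ[X]} {T : Finset ℤ} {M : ℕ}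
    (hP : P.degree < (T.card : WithBot ℕ)) (hint : ∀ n ∈ T, ∃ y : ℤ, P.eval (n : ℚ) = y)
    (hM : ∀ a ∈ T, ∀ b ∈ T, (a - b).natAbs ≤ M) :
    denominator P ≤ M ^ (T.card * (T.card - 1) / 2) := by
  obtain ⟨v, hv, hvM, hcl⟩ := exists_clears M T hM
  exact (denominator_le hP hint hv hcl).trans hvM

/-- Inserting `i` last keeps its differences exact. Read backwards, this bounds the product from
below in terms of the denominator. -/
theorem denominator_le_pow_mul_prod {P : ℚ[X]} {T : Finset ℤ} {M : ℕ}
    (hP : P.degree < (T.card : WithBot ℕ)) (hint : ∀ n ∈ T, ∃ y : ℤ, P.eval (n : ℚ) = y)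
    (hM : ∀ a ∈ T, ∀ b ∈ T, (a - b).natAbs ≤ M) {i : ℤ} (hi : i ∈ T) :
    denominator P ≤ M ^ ((T.card - 1) * (T.card - 2) / 2) * ∏ j ∈ T.erase i, (i - j).natAbs := by
  obtain ⟨v, hv, hvM, hcl⟩ := exists_clears M (T.erase i) fun a ha b hb =>
    hM a (Finset.mem_of_mem_erase ha) b (Finset.mem_of_mem_erase hb)
  have h := hcl.insert (Finset.notMem_erase i T)
  rw [Finset.insert_erase hi] at h
  rw [Finset.card_erase_of_mem hi] at hvM
  refine (denominator_le hP hint (Nat.mul_pos hv (Finset.prod_pos fun j hj => ?_)) h).trans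
    (Nat.mul_le_mul_right _ hvM)
  rw [Int.natAbs_pos, sub_ne_zero]
  exact (Finset.ne_of_mem_erase hj).symm

/-- Only `k` of the `k + 1` points are needed to clear denominators. Dropping one at distance at
least half the diameter from `i` lets a factor `M` be traded for twice its difference with `i`. -/
theorem denominator_le_two_mul_prod {k : ℕ} (hk : 3 ≤ k) {P : ℚ[X]} {U : Finset ℤ}
    (hU : U.card = k + 1) (hP : P.degree < (k : WithBot ℕ))
    (hint : ∀ n ∈ U, ∃ y : ℤ, P.eval (n : ℚ) = y) {X : ℝ}
    (hX : ∀ a ∈ U, ∀ b ∈ U, |(a : ℝ) - b| ≤ X) {i : ℤ} (hi : i ∈ U) :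
    (denominator P : ℝ) ≤ 2 * X ^ (k * (k - 3) / 2) * ∏ j ∈ U.erase i, |(i : ℝ) - j| := by
  have hne : (U ×ˢ U).Nonempty := ⟨(i, i), Finset.mem_product.2 ⟨hi, hi⟩⟩
  obtain ⟨⟨a, b⟩, hab, hmax⟩ := Finset.exists_max_image (U ×ˢ U)
    (fun p : ℤ × ℤ => (p.1 - p.2).natAbs) hne
  obtain ⟨ha, hb⟩ := Finset.mem_product.1 hab
  set M := (a - b).natAbs with hMdef
  have hM : ∀ x ∈ U, ∀ y ∈ U, (x - y).natAbs ≤ M := fun x hx y hy =>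
    hmax (x, y) (Finset.mem_product.2 ⟨hx, hy⟩)
  have hMX : (M : ℝ) ≤ X := by
    have := hX a ha b hb
    rw [hMdef, Nat.cast_natAbs]
    push_cast
    exact this
  obtain ⟨w, hw, hwi⟩ : ∃ w ∈ U, w ≠ i :=
    Finset.exists_mem_ne (by omega) i
  have hM1 : 1 ≤ M := by
    have := hM w hw i hi
    have : 0 < (w - i).natAbs := by rw [Int.natAbs_pos, sub_ne_zero]; exact hwi
    omega
  -- One of the two points realising the diameter is at least half of it away from `i`.
  obtain ⟨j₀, hj₀, hfar⟩ : ∃ j ∈ U, M ≤ 2 * (i - j).natAbs := by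
    by_cases h : M ≤ 2 * (i - a).natAbs
    · exact ⟨a, ha, h⟩
    · exact ⟨b, hb, by omega⟩
  have hij : i ≠ j₀ := by
    rintro rfl
    simp at hfar
    omega
  have hcard : (U.erase j₀).card = k := by rw [Finset.card_erase_of_mem hj₀]; omega
  have h1 := denominator_le_pow_mul_prod (P := P) (T := U.erase j₀) (M := M)
    (by rw [hcard]; exact hP) (fun n hn => hint n (Finset.mem_of_mem_erase hn))
    (fun x hx y hy => hM x (Finset.mem_of_mem_erase hx) y (Finset.mem_of_mem_erase hy))
    (Finset.mem_erase.2 ⟨hij, hi⟩)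
  have hexp : (k - 1) * (k - 2) / 2 = k * (k - 3) / 2 + 1 := by
    obtain ⟨m, rfl⟩ := Nat.exists_eq_add_of_le hk
    have h1 : (3 + m - 1) * (3 + m - 2) = (3 + m) * (3 + m - 3) + 2 := by
      have e1 : 3 + m - 1 = m + 2 := by omega
      have e2 : 3 + m - 2 = m + 1 := by omega
      have e3 : 3 + m - 3 = m := by omega
      rw [e1, e2, e3]; ring
    rw [h1]; omega
  rw [hcard, hexp, pow_succ] at h1
  have h2 : ∏ j ∈ U.erase i, (i - j).natAbs =
      (i - j₀).natAbs * ∏ j ∈ (U.erase j₀).erase i, (i - j).natAbs := by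
    rw [Finset.erase_right_comm]
    exact (Finset.mul_prod_erase _ _ (Finset.mem_erase.2 ⟨hij.symm, hj₀⟩)).symm
  have h3 : denominator P ≤ 2 * M ^ (k * (k - 3) / 2) * ∏ j ∈ U.erase i, (i - j).natAbs := by
    refine h1.trans ?_
    rw [h2]
    calc M ^ (k * (k - 3) / 2) * M * ∏ j ∈ (U.erase j₀).erase i, (i - j).natAbs
        ≤ M ^ (k * (k - 3) / 2) * (2 * (i - j₀).natAbs) *
          ∏ j ∈ (U.erase j₀).erase i, (i - j).natAbs := by gcongr
      _ = _ := by ring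
  have h4 : ((∏ j ∈ U.erase i, (i - j).natAbs : ℕ) : ℝ) = ∏ j ∈ U.erase i, |(i : ℝ) - j| := by
    push_cast
    exact Finset.prod_congr rfl fun j _ => by rw [Nat.cast_natAbs]; push_cast; rfl
  calc (denominator P : ℝ)
      ≤ ((2 * M ^ (k * (k - 3) / 2) * ∏ j ∈ U.erase i, (i - j).natAbs : ℕ) : ℝ) := by
        exact_mod_cast h3
    _ = 2 * (M : ℝ) ^ (k * (k - 3) / 2) * ∏ j ∈ U.erase i, |(i : ℝ) - j| := by
        rw [Nat.cast_mul, h4]; push_cast; rfl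
    _ ≤ _ := by
        have : 0 ≤ ∏ j ∈ U.erase i, |(i : ℝ) - j| := Finset.prod_nonneg fun _ _ => abs_nonneg _
        gcongr

/-! ### Bounds for `f - P` from its values at a few points -/

/-- The hypotheses on the function: `f ∈ C^k[N, 2N]` and `lam ≤ |f^(k)| ≤ c lam`. -/
structure Bounds (k N : ℕ) (f : ℝ → ℝ) (lam c : ℝ) : Prop where
  pos : 0 < N
  contDiffOn : ContDiffOn ℝ k f (Set.Icc (N : ℝ) (2 * (N : ℝ)))
  lam_pos : 0 < lam
  one_le : 1 ≤ c
  le_deriv : ∀ x ∈ Set.Icc (N : ℝ) (2 * (N : ℝ)),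
    lam ≤ |iteratedDerivWithin k f (Set.Icc (N : ℝ) (2 * (N : ℝ))) x|
  deriv_le : ∀ x ∈ Set.Icc (N : ℝ) (2 * (N : ℝ)),
    |iteratedDerivWithin k f (Set.Icc (N : ℝ) (2 * (N : ℝ))) x| ≤ c * lam

section

variable {k N : ℕ} {f : ℝ → ℝ} {lam c δ : ℝ}

theorem Bounds.lam_le (hB : Bounds k N f lam c) {P : ℚ[X]}
    (hP : P.degree < (k : WithBot ℕ)) {U : Finset ℤ} (hU : U.card = k + 1)
    (hmem : ∀ n ∈ U, (n : ℝ) ∈ Set.Icc (N : ℝ) (2 * (N : ℝ)))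
    (hg : ∀ n ∈ U, |f n - aeval (n : ℝ) P| ≤ δ) {r : ℝ} (hr0 : 0 < r)
    (hr : ∀ i ∈ U, r ≤ ∏ j ∈ U.erase i, |(i : ℝ) - j|) :
    lam / k.factorial ≤ (k + 1) * δ / r := by
  have hab : (N : ℝ) < 2 * N := by have : (0 : ℝ) < N := by exact_mod_cast hB.pos
                                   linarith
  obtain ⟨ξ, hξ, h⟩ := exists_sum_sub_div_eq_iteratedDerivWithin hab hB.contDiffOn hP hU hmem
  have hk0 : (0 : ℝ) < k.factorial := by positivity
  calc lam / k.factorial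
      ≤ |iteratedDerivWithin k f (Set.Icc (N : ℝ) (2 * (N : ℝ))) ξ| / k.factorial := by
        gcongr; exact hB.le_deriv ξ hξ
    _ = |∑ i ∈ U, (f i - aeval (i : ℝ) P) / ∏ j ∈ U.erase i, ((i : ℝ) - j)| := by
        rw [h, abs_div, abs_of_pos hk0]
    _ ≤ ∑ i ∈ U, |(f i - aeval (i : ℝ) P) / ∏ j ∈ U.erase i, ((i : ℝ) - j)| :=
        Finset.abs_sum_le_sum_abs _ _
    _ ≤ ∑ i ∈ U, δ / r := by
        refine Finset.sum_le_sum fun i hi => ?_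
        rw [abs_div, Finset.abs_prod]
        have := hg i hi
        exact div_le_div₀ ((abs_nonneg _).trans this) this hr0 (hr i hi)
    _ = (k + 1) * δ / r := by
        rw [Finset.sum_const, hU, nsmul_eq_mul]; push_cast; ring

/-- The mean value formula on `T ∪ {x}`, solved for `f x - P x`, leaves a Lagrange interpolation
term on `T` and a derivative term. The latter is at most `c * lam / k!` times a product, and `U`
bounds `lam / k!`. -/
theorem Bounds.abs_sub_le (hB : Bounds k N f lam c) {P : ℚ[X]}
    (hP : P.degree < (k : WithBot ℕ)) {U T : Finset ℤ} (hU : U.card = k + 1)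
    (hTU : T ⊆ U) (hT : T.card = k)
    (hmem : ∀ n ∈ U, (n : ℝ) ∈ Set.Icc (N : ℝ) (2 * (N : ℝ)))
    (hg : ∀ n ∈ U, |f n - aeval (n : ℝ) P| ≤ δ) {r r' D : ℝ} (hr0 : 0 < r) (hr0' : 0 < r')
    (hr : ∀ i ∈ U, r ≤ ∏ j ∈ U.erase i, |(i : ℝ) - j|)
    (hr' : ∀ i ∈ T, r' ≤ ∏ j ∈ T.erase i, |(i : ℝ) - j|) {x : ℤ} (hx : x ∉ T)
    (hxm : (x : ℝ) ∈ Set.Icc (N : ℝ) (2 * (N : ℝ))) (hD : ∀ j ∈ T, |(x : ℝ) - j| ≤ D) :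
    |f x - aeval (x : ℝ) P| ≤
      k * δ * (D ^ (k - 1) / r') + c * (k + 1) * δ * (D ^ k / r) := by
  classical
  have hlam := hB.lam_le hP hU hmem hg hr0 hr
  have hab : (N : ℝ) < 2 * N := by have : (0 : ℝ) < N := by exact_mod_cast hB.pos
                                   linarith
  have hcard : (insert x T).card = k + 1 := by rw [Finset.card_insert_of_notMem hx, hT]
  obtain ⟨ξ, hξ, h⟩ := exists_sum_sub_div_eq_iteratedDerivWithin hab hB.contDiffOn hP hcard
    (by
      intro n hn
      rcases Finset.mem_insert.1 hn with rfl | hn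
      · exact hxm
      · exact hmem n (hTU hn))
  set F := iteratedDerivWithin k f (Set.Icc (N : ℝ) (2 * (N : ℝ))) ξ with hF
  have hk0 : (0 : ℝ) < k.factorial := by positivity
  set w := ∏ j ∈ T, ((x : ℝ) - j) with hw
  have hxj : ∀ j ∈ T, (x : ℝ) - j ≠ 0 := by
    intro j hj h0
    have : x = j := by exact_mod_cast sub_eq_zero.1 h0
    exact hx (this ▸ hj)
  have hw0 : w ≠ 0 := Finset.prod_ne_zero_iff.2 hxj
  rw [Finset.sum_insert hx, Finset.erase_insert hx] at h
  have hterm : ∀ i ∈ T, (f i - aeval (i : ℝ) P) / ∏ j ∈ (insert x T).erase i, ((i : ℝ) - j) =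
      -((f i - aeval (i : ℝ) P) * ((∏ j ∈ T.erase i, ((x : ℝ) - j)) /
        ∏ j ∈ T.erase i, ((i : ℝ) - j)) / w) := by
    intro i hi
    have hxi : x ≠ i := by rintro rfl; exact hx hi
    have h1 : (insert x T).erase i = insert x (T.erase i) := Finset.erase_insert_of_ne hxi
    have h2 : x ∉ T.erase i := fun h => hx (Finset.mem_of_mem_erase h)
    have h3 : w = ((x : ℝ) - i) * ∏ j ∈ T.erase i, ((x : ℝ) - j) :=
      (Finset.mul_prod_erase T (fun j : ℤ => (x : ℝ) - j) hi).symm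
    have h4 : ∏ j ∈ T.erase i, ((x : ℝ) - j) ≠ 0 :=
      Finset.prod_ne_zero_iff.2 fun j hj => hxj j (Finset.mem_of_mem_erase hj)
    have h5 := hxj i hi
    have h6 : ∏ j ∈ T.erase i, ((i : ℝ) - j) ≠ 0 := by
      refine Finset.prod_ne_zero_iff.2 fun j hj => sub_ne_zero.2 ?_
      exact_mod_cast (Finset.ne_of_mem_erase hj).symm
    have h7 : (i : ℝ) - x ≠ 0 := by rw [← neg_sub]; exact neg_ne_zero.2 h5
    rw [h1, Finset.prod_insert h2, h3]
    rw [← neg_sub (x : ℝ) i]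
    field_simp
  rw [Finset.sum_congr rfl hterm, Finset.sum_neg_distrib, ← Finset.sum_div, ← sub_eq_add_neg,
    ← sub_div, div_eq_iff hw0] at h
  have hgx : f x - aeval (x : ℝ) P = F / k.factorial * w +
      ∑ i ∈ T, (f i - aeval (i : ℝ) P) * ((∏ j ∈ T.erase i, ((x : ℝ) - j)) /
        ∏ j ∈ T.erase i, ((i : ℝ) - j)) := by linarith
  have hc0 : 0 ≤ c := by linarith [hB.one_le]
  have hwD : |w| ≤ D ^ k := by
    rw [hw, Finset.abs_prod]
    refine (Finset.prod_le_prod (fun _ _ => abs_nonneg _) hD).trans ?_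
    rw [Finset.prod_const, hT]
  have hfirst : |F / k.factorial * w| ≤ c * (k + 1) * δ * (D ^ k / r) := by
    rw [abs_mul, abs_div, abs_of_pos hk0]
    have h1 : |F| / k.factorial ≤ c * ((k + 1) * δ / r) :=
      calc |F| / k.factorial ≤ c * lam / k.factorial := by gcongr; exact hB.deriv_le ξ hξ
        _ = c * (lam / k.factorial) := by ring
        _ ≤ _ := by gcongr
    calc |F| / k.factorial * |w| ≤ c * ((k + 1) * δ / r) * D ^ k :=
          mul_le_mul h1 hwD (abs_nonneg _) ((by positivity : 0 ≤ |F| / k.factorial).trans h1)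
      _ = _ := by ring
  have hsecond : |∑ i ∈ T, (f i - aeval (i : ℝ) P) * ((∏ j ∈ T.erase i, ((x : ℝ) - j)) /
        ∏ j ∈ T.erase i, ((i : ℝ) - j))| ≤ k * δ * (D ^ (k - 1) / r') := by
    refine (Finset.abs_sum_le_sum_abs _ _).trans ?_
    have : ∀ i ∈ T, |(f i - aeval (i : ℝ) P) * ((∏ j ∈ T.erase i, ((x : ℝ) - j)) /
        ∏ j ∈ T.erase i, ((i : ℝ) - j))| ≤ δ * (D ^ (k - 1) / r') := by
      intro i hi
      have hgi := hg i (hTU hi)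
      rw [abs_mul, abs_div, Finset.abs_prod, Finset.abs_prod]
      have h1 : ∏ j ∈ T.erase i, |(x : ℝ) - j| ≤ D ^ (k - 1) := by
        refine (Finset.prod_le_prod (fun _ _ => abs_nonneg _)
          fun j hj => hD j (Finset.mem_of_mem_erase hj)).trans ?_
        rw [Finset.prod_const, Finset.card_erase_of_mem hi, hT]
      have h0 : 0 ≤ ∏ j ∈ T.erase i, |(x : ℝ) - j| := Finset.prod_nonneg fun _ _ => abs_nonneg _
      exact mul_le_mul hgi (div_le_div₀ (h0.trans h1) h1 hr0' (hr' i hi))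
        (div_nonneg h0 (Finset.prod_nonneg fun _ _ => abs_nonneg _)) ((abs_nonneg _).trans hgi)
    refine (Finset.sum_le_sum this).trans ?_
    rw [Finset.sum_const, hT, nsmul_eq_mul, mul_assoc]
  rw [hgx]
  refine (abs_add_le _ _).trans ?_
  linarith

end

/-! ### Points of `S` forced into a major arc -/

theorem aeval_intCast (P : ℚ[X]) (n : ℤ) : aeval (n : ℝ) P = ((P.eval (n : ℚ) : ℚ) : ℝ) := by
  have h := Polynomial.aeval_algebraMap_apply ℝ (n : ℚ) P
  simp only [map_intCast, eq_ratCast] at h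
  rw [h, Polynomial.coe_aeval_eq_eval]

section

variable {k N : ℕ} {f : ℝ → ℝ} {lam c δ : ℝ} {A : Finset ℤ} {P : ℚ[X]}

theorem mem_S {n : ℤ} : n ∈ S f N δ ↔
    ((N : ℤ) ≤ n ∧ n ≤ 2 * (N : ℤ)) ∧ |f n - round (f n)| < δ := by
  classical
  simp [S]

theorem mem_Icc_of_mem_S {n : ℤ} (hn : n ∈ S f N δ) :
    (n : ℝ) ∈ Set.Icc (N : ℝ) (2 * (N : ℝ)) := by
  obtain ⟨⟨h1, h2⟩, -⟩ := mem_S.1 hn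
  exact ⟨by exact_mod_cast h1, by exact_mod_cast h2⟩

theorem IsMajorArc.mem_S (hA : IsMajorArc k f N δ A P) {n : ℤ} (hn : n ∈ A) : n ∈ S f N δ :=
  hA.consecutive.1 hn

theorem LiesOn.exists_int {A : Finset ℤ} (hA : LiesOn f A P) :
    ∀ n ∈ A, ∃ y : ℤ, P.eval (n : ℚ) = y :=
  fun n hn => ⟨_, (hA n hn).symm⟩

theorem IsMajorArc.abs_sub_le (hA : IsMajorArc k f N δ A P) {n : ℤ} (hn : n ∈ A) :
    |f n - aeval (n : ℝ) P| ≤ δ := by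
  rw [aeval_intCast, ← hA.liesOn n hn, Rat.cast_intCast]
  exact (MajorArcs.mem_S.1 (hA.mem_S hn)).2.le

/-- Consecutive points on the curve that meet a major arc are part of it. -/
theorem IsMajorArc.subset_of_liesOn (hA : IsMajorArc k f N δ A P) {W : Finset ℤ}
    (hW : IsConsecutive f N δ W) (hP : LiesOn f W P) {z : ℤ} (hzA : z ∈ A) (hzW : z ∈ W) :
    W ⊆ A := by
  classical
  have h := hA.maximal (A ∪ W) ⟨Finset.union_subset hA.consecutive.1 hW.1, ?_⟩ ?_
    Finset.subset_union_left
  · rw [← h]; exact Finset.subset_union_right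
  -- The common point `z` bridges `A` and `W`: a point between them is on one side of `z`.
  · intro a ha b hb n hn han hnb
    have h1 := hA.consecutive.2
    have h2 := hW.2
    rw [Finset.mem_union] at ha hb ⊢
    rcases ha with ha | ha <;> rcases hb with hb | hb
    · exact Or.inl (h1 a ha b hb n hn han hnb)
    · rcases le_total n z with hz | hz
      · exact Or.inl (h1 a ha z hzA n hn han hz)
      · exact Or.inr (h2 z hzW b hb n hn hz hnb)
    · rcases le_total n z with hz | hz
      · exact Or.inr (h2 a ha z hzW n hn han hz)
      · exact Or.inl (h1 z hzA b hb n hn hz hnb)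
    · exact Or.inr (h2 a ha b hb n hn han hnb)
  · intro n hn
    rcases Finset.mem_union.1 hn with hn | hn
    · exact hA.liesOn n hn
    · exact hP n hn

/-- Two polynomials of degree `< k` agreeing at `k` points are equal; maximality then gives both
inclusions. -/
theorem IsMajorArc.eq_of_card_inter (hk : 0 < k) {A' : Finset ℤ} {P' : ℚ[X]}
    (hA : IsMajorArc k f N δ A P) (hA' : IsMajorArc k f N δ A' P')
    (h : k ≤ (A ∩ A').card) : A = A' := by
  have hPP : P = P' := by
    refine Polynomial.eq_of_degrees_lt_of_eval_finset_eq
      ((A ∩ A').map ⟨fun n : ℤ => (n : ℚ), Int.cast_injective⟩) ?_ ?_ ?_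
    · rw [Finset.card_map]; exact hA.degree_lt.trans_le (by exact_mod_cast h)
    · rw [Finset.card_map]; exact hA'.degree_lt.trans_le (by exact_mod_cast h)
    · intro x hx
      obtain ⟨n, hn, rfl⟩ := Finset.mem_map.1 hx
      obtain ⟨h1, h2⟩ := Finset.mem_inter.1 hn
      exact (hA.liesOn n h1).symm.trans (hA'.liesOn n h2)
  subst hPP
  obtain ⟨z, hz⟩ := Finset.card_pos.1 (hk.trans_le h)
  obtain ⟨h1, h2⟩ := Finset.mem_inter.1 hz
  exact (hA'.subset_of_liesOn hA.consecutive hA.liesOn h2 h1).antisymm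
    (hA.subset_of_liesOn hA'.consecutive hA'.liesOn h1 h2)

theorem IsMajorArc.denominator_spec (hA : IsMajorArc k f N δ A P) :
    0 < denominator P ∧ ∃ R : ℤ[X], R.map (Int.castRingHom ℚ) = C (denominator P : ℚ) * P :=
  MajorArcs.denominator_spec (T := A)
    (hA.degree_lt.trans_le (by exact_mod_cast (Nat.le_succ k).trans hA.card_ge))
    hA.liesOn.exists_int

/-- `q P` has integer coefficients, so `⌊f x⌉ - P x` is a multiple of `1/q`. -/
theorem IsMajorArc.round_eq_of_abs_lt (hA : IsMajorArc k f N δ A P) {x : ℤ}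
    (h : |(round (f x) : ℝ) - aeval (x : ℝ) P| < 1 / denominator P) :
    ((round (f x) : ℤ) : ℚ) = P.eval (x : ℚ) := by
  obtain ⟨hq, R, hR⟩ := hA.denominator_spec
  set q := denominator P
  have hqR : (0 : ℝ) < q := by exact_mod_cast hq
  have hRx : ((R.eval x : ℤ) : ℚ) = q * P.eval (x : ℚ) := by
    have := congrArg (fun p => p.eval (x : ℚ)) hR
    simp only [eval_mul, eval_C] at this
    rw [← this, eval_intCast_map]
    simp
  have hint : |((q * round (f x) - R.eval x : ℤ) : ℝ)| < 1 := by
    have h1 : ((R.eval x : ℤ) : ℝ) = q * aeval (x : ℝ) P := by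
      rw [aeval_intCast]; exact_mod_cast congrArg (fun z : ℚ => (z : ℝ)) hRx
    push_cast
    rw [h1, ← mul_sub, abs_mul, abs_of_pos hqR]
    calc (q : ℝ) * |(round (f x) : ℝ) - aeval (x : ℝ) P| < q * (1 / q) := by gcongr
      _ = 1 := by field_simp
  have h0 : (q : ℤ) * round (f x) - R.eval x = 0 := by
    rw [← Int.abs_lt_one_iff]; exact_mod_cast hint
  have h2 : (q : ℚ) * (round (f x) : ℤ) = q * P.eval (x : ℚ) := by
    rw [← hRx]; exact_mod_cast sub_eq_zero.1 h0
  exact mul_left_cancel₀ (by exact_mod_cast hq.ne') h2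

/-- Points of `S` near `k + 1` well-spaced points of a major arc lie on its curve. -/
theorem IsMajorArc.round_eq_of_near (hB : Bounds k N f lam c) (hk : 3 ≤ k) (hδ : 0 < δ)
    (hA : IsMajorArc k f N δ A P) (hq : 6 * c * (k + 1) * δ * denominator P ≤ 1)
    {U T : Finset ℤ} (hUA : U ⊆ A) (hU : U.card = k + 1) (hTU : T ⊆ U) (hT : T.card = k)
    {r r' D : ℝ} (hr0 : 0 < r) (hr0' : 0 < r')
    (hr : ∀ i ∈ U, r ≤ ∏ j ∈ U.erase i, |(i : ℝ) - j|)
    (hr' : ∀ i ∈ T, r' ≤ ∏ j ∈ T.erase i, |(i : ℝ) - j|)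
    (hDr' : D ^ (k - 1) / r' ≤ 1 / (6 * c * (k + 1) * δ * denominator P))
    (hDr : D ^ k / r ≤ 2 / (6 * c * (k + 1) * δ * denominator P))
    {x : ℤ} (hx : x ∈ S f N δ) (hD : ∀ j ∈ T, |(x : ℝ) - j| ≤ D) :
    ((round (f x) : ℤ) : ℚ) = P.eval (x : ℚ) := by
  by_cases hxT : x ∈ T
  · exact hA.liesOn x (hUA (hTU hxT))
  have hc := hB.one_le
  have hc0 : 0 < c := by linarith
  have hq0 : (0 : ℝ) < denominator P := by exact_mod_cast hA.denominator_spec.1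
  set q : ℝ := ((denominator P : ℕ) : ℝ)
  have hg := hB.abs_sub_le (U := U) (T := T) hA.degree_lt hU hTU hT
    (fun n hn => mem_Icc_of_mem_S (hA.mem_S (hUA hn))) (fun n hn => hA.abs_sub_le (hUA hn))
    hr0 hr0' hr hr' hxT (mem_Icc_of_mem_S hx) hD
  have hk1 : (3 : ℝ) ≤ k := by exact_mod_cast hk
  -- Error budget: `1/(6q)` for interpolation, `1/(3q)` for the derivative and `1/(24q)` for
  -- rounding, in all `13/(24q) < 1/q`.
  have hb1 : k * δ * (D ^ (k - 1) / r') ≤ 1 / (6 * q) :=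
    calc k * δ * (D ^ (k - 1) / r') ≤ k * δ * (1 / (6 * c * (k + 1) * δ * q)) := by gcongr
      _ ≤ (c * (k + 1)) * δ * (1 / (6 * c * (k + 1) * δ * q)) := by
          gcongr
          nlinarith
      _ = 1 / (6 * q) := by field_simp
  have hb2 : c * (k + 1) * δ * (D ^ k / r) ≤ 1 / (3 * q) :=
    calc c * (k + 1) * δ * (D ^ k / r) ≤ c * (k + 1) * δ * (2 / (6 * c * (k + 1) * δ * q)) := by
          gcongr
      _ = 1 / (3 * q) := by field_simp; norm_num
  have hδq : δ ≤ 1 / (24 * q) := by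
    rw [le_div_iff₀ (by positivity)]
    have : δ * (24 * q) ≤ 6 * c * (k + 1) * δ * q := by
      have : (4 : ℝ) ≤ c * (k + 1) := by nlinarith
      have h2 : 0 ≤ δ * q := by positivity
      nlinarith
    linarith
  refine hA.round_eq_of_abs_lt ?_
  have hfx := (MajorArcs.mem_S.1 hx).2
  have htri : |(round (f x) : ℝ) - aeval (x : ℝ) P| ≤
      |f x - round (f x)| + |f x - aeval (x : ℝ) P| := by
    rw [abs_sub_comm (f x)]; exact _root_.abs_sub_le _ _ _
  calc |(round (f x) : ℝ) - aeval (x : ℝ) P| < 1 / (24 * q) + (1 / (6 * q) + 1 / (3 * q)) := by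
        linarith
    _ = (13 / 24) * (1 / q) := by field_simp; norm_num
    _ < 1 / q := by
        have : 0 < 1 / q := by positivity
        linarith

/-- A short window containing `k + 1` points of a major arc contains no other point of `S`. -/
theorem IsMajorArc.window_subset (hB : Bounds k N f lam c) (hk : 3 ≤ k) (hδ : 0 < δ)
    (hA : IsMajorArc k f N δ A P) {X : ℝ} (hX : X ^ (k * (k - 1) / 2) * (6 * c * (k + 1) * δ) ≤ 1)
    {W : Finset ℤ} (hW : IsConsecutive f N δ W) (hWX : ∀ a ∈ W, ∀ b ∈ W, |(a : ℝ) - b| ≤ X)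
    (hcard : k + 1 ≤ (A ∩ W).card) :
    W ⊆ A ∧ 6 * c * (k + 1) * δ * denominator P ≤ 1 := by
  obtain ⟨U, hUAW, hU⟩ := Finset.exists_subset_card_eq hcard
  obtain ⟨T, hTU, hT⟩ := Finset.exists_subset_card_eq (by omega : k ≤ U.card)
  have hUA : U ⊆ A := fun n hn => (Finset.mem_inter.1 (hUAW hn)).1
  have hUW : U ⊆ W := fun n hn => (Finset.mem_inter.1 (hUAW hn)).2
  have hc := hB.one_le
  have hc0 : 0 < c := by linarith
  set Y := 6 * c * (k + 1) * δ with hYdef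
  have hY : 0 < Y := by positivity
  have hq0 : (0 : ℝ) < denominator P := by exact_mod_cast hA.denominator_spec.1
  have hTd : P.degree < (T.card : WithBot ℕ) := by rw [hT]; exact hA.degree_lt
  have hTint : ∀ n ∈ T, ∃ y : ℤ, P.eval (n : ℚ) = y :=
    fun n hn => hA.liesOn.exists_int n (hUA (hTU hn))
  have hXpos : 0 < X := by
    obtain ⟨a, ha, b, hb, hab⟩ := Finset.one_lt_card.1 (by omega : 1 < U.card)
    refine lt_of_lt_of_le ?_ (hWX a (hUW ha) b (hUW hb))
    rw [abs_pos, sub_ne_zero]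
    exact_mod_cast hab
  have hTM : ∀ a ∈ T, ∀ b ∈ T, (a - b).natAbs ≤ ⌊X⌋₊ := by
    intro a ha b hb
    refine Nat.le_floor ?_
    rw [Nat.cast_natAbs]
    push_cast
    exact hWX a (hUW (hTU ha)) b (hUW (hTU hb))
  have hfl : (⌊X⌋₊ : ℝ) ≤ X := Nat.floor_le hXpos.le
  have hq : (denominator P : ℝ) ≤ X ^ (k * (k - 1) / 2) := by
    have h := denominator_le_pow hTd hTint hTM
    rw [hT] at h
    calc (denominator P : ℝ) ≤ (⌊X⌋₊ : ℝ) ^ (k * (k - 1) / 2) := by exact_mod_cast h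
      _ ≤ _ := by gcongr
  have hYq : Y * denominator P ≤ 1 := by
    refine le_trans ?_ hX
    rw [mul_comm]
    gcongr
  have hdY : X ^ (k * (k - 1) / 2) / denominator P ≤ 1 / (Y * denominator P) := by
    rw [div_le_div_iff₀ hq0 (by positivity)]
    calc X ^ (k * (k - 1) / 2) * (Y * denominator P)
        = (X ^ (k * (k - 1) / 2) * Y) * denominator P := by ring
      _ ≤ 1 * denominator P := by gcongr
  refine ⟨?_, hYq⟩
  obtain ⟨z, hz⟩ := Finset.card_pos.1 (by omega : 0 < U.card)
  refine hA.subset_of_liesOn hW (fun x hx => ?_) (hUA hz) (hUW hz)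
  have he1 : k * (k - 1) / 2 = (k - 1) + (k - 1) * (k - 2) / 2 := by
    obtain ⟨m, rfl⟩ := Nat.exists_eq_add_of_le hk
    have e0 : (3 + m) * (3 + m - 1) = 2 * (3 + m - 1) + (3 + m - 1) * (3 + m - 2) := by
      have e1 : 3 + m - 1 = m + 2 := by omega
      have e2 : 3 + m - 2 = m + 1 := by omega
      rw [e1, e2]; ring
    rw [e0]; omega
  have he2 : k * (k - 1) / 2 = k + k * (k - 3) / 2 := by
    obtain ⟨m, rfl⟩ := Nat.exists_eq_add_of_le hk
    have e0 : (3 + m) * (3 + m - 1) = 2 * (3 + m) + (3 + m) * (3 + m - 3) := by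
      have e1 : 3 + m - 1 = m + 2 := by omega
      have e2 : 3 + m - 3 = m := by omega
      rw [e1, e2]; ring
    rw [e0]; omega
  -- `r` and `r'` are the lower bounds for the products given by the denominator. They make `X^k /
  -- r` and `X^(k-1) / r'` equal to `2 X^n / q` and `X^n / q`, with `n = k(k-1)/2`.
  refine hA.round_eq_of_near hB hk hδ hYq hUA hU hTU hT (D := X)
    (r := denominator P / (2 * X ^ (k * (k - 3) / 2)))
    (r' := denominator P / X ^ ((k - 1) * (k - 2) / 2)) (by positivity) (by positivity)
    ?_ ?_ ?_ ?_ (hW.1 hx) (fun j hj => hWX x hx j (hUW (hTU hj)))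
  · intro i hi
    rw [div_le_iff₀ (by positivity), mul_comm]
    exact denominator_le_two_mul_prod hk hU hA.degree_lt
      (fun n hn => hA.liesOn.exists_int n (hUA hn))
      (fun a ha b hb => hWX a (hUW ha) b (hUW hb)) hi
  · intro i hi
    rw [div_le_iff₀ (by positivity), mul_comm]
    have h := denominator_le_pow_mul_prod hTd hTint hTM hi
    rw [hT] at h
    have h4 : ((∏ j ∈ T.erase i, (i - j).natAbs : ℕ) : ℝ) = ∏ j ∈ T.erase i, |(i : ℝ) - j| := by
      push_cast
      exact Finset.prod_congr rfl fun j _ => by rw [Nat.cast_natAbs]; push_cast; rfl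
    calc (denominator P : ℝ)
        ≤ ((⌊X⌋₊ ^ ((k - 1) * (k - 2) / 2) * ∏ j ∈ T.erase i, (i - j).natAbs : ℕ) : ℝ) := by
          exact_mod_cast h
      _ = (⌊X⌋₊ : ℝ) ^ ((k - 1) * (k - 2) / 2) * ∏ j ∈ T.erase i, |(i : ℝ) - j| := by
          rw [Nat.cast_mul, h4]; push_cast; rfl
      _ ≤ _ := by
          have : 0 ≤ ∏ j ∈ T.erase i, |(i : ℝ) - j| := Finset.prod_nonneg fun _ _ => abs_nonneg _
          gcongr
  · refine le_trans (le_of_eq ?_) hdY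
    rw [he1, pow_add]; field_simp
  · refine le_trans (le_of_eq ?_) (le_trans (mul_le_mul_of_nonneg_left hdY zero_le_two)
      (le_of_eq ?_))
    · rw [he2, pow_add]; field_simp
    · ring

/-- Points of `S` at distance `≤ h (Y q)^{-1/k}` from `k + 1` points of a major arc with gaps
`≥ h` are in the arc. -/
theorem IsMajorArc.subset_of_gaps (hB : Bounds k N f lam c) (hk : 3 ≤ k) (hδ : 0 < δ)
    (hA : IsMajorArc k f N δ A P) (hq : 6 * c * (k + 1) * δ * denominator P ≤ 1)
    {U : Finset ℤ} (hUA : U ⊆ A) (hU : U.card = k + 1) {h D : ℝ} (hh : 0 < h)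
    (hgap : ∀ a ∈ U, ∀ b ∈ U, a ≠ b → h ≤ |(a : ℝ) - b|) (hhD : h ≤ D)
    (hD : (D / h) ^ k ≤ 1 / (6 * c * (k + 1) * δ * denominator P))
    {W : Finset ℤ} (hW : IsConsecutive f N δ W) (hWD : ∀ x ∈ W, ∀ j ∈ U, |(x : ℝ) - j| ≤ D)
    {z : ℤ} (hzA : z ∈ A) (hzW : z ∈ W) : W ⊆ A := by
  obtain ⟨T, hTU, hT⟩ := Finset.exists_subset_card_eq (by omega : k ≤ U.card)
  have hprod : ∀ V : Finset ℤ, V ⊆ U → ∀ i ∈ V,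
      h ^ (V.card - 1) ≤ ∏ j ∈ V.erase i, |(i : ℝ) - j| := by
    intro V hV i hi
    rw [← Finset.card_erase_of_mem hi, ← Finset.prod_const]
    refine Finset.prod_le_prod (fun _ _ => hh.le) fun j hj => ?_
    exact hgap i (hV hi) j (hV (Finset.mem_of_mem_erase hj)) (Finset.ne_of_mem_erase hj).symm
  have h1 : 1 ≤ D / h := by rwa [le_div_iff₀ hh, one_mul]
  refine hA.subset_of_liesOn hW (fun x hx => ?_) hzA hzW
  refine hA.round_eq_of_near hB hk hδ hq hUA hU hTU hT (D := D) (r := h ^ k) (r' := h ^ (k - 1))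
    (by positivity) (by positivity) ?_ ?_ ?_ ?_ (hW.1 hx) (fun j hj => hWD x hx j (hTU hj))
  · intro i hi
    have := hprod U subset_rfl i hi
    rwa [hU, Nat.add_sub_cancel] at this
  · intro i hi
    have := hprod T hTU i hi
    rwa [hT] at this
  · rw [← div_pow]
    exact (pow_le_pow_right₀ h1 (Nat.sub_le k 1)).trans hD
  · rw [← div_pow]
    refine hD.trans ?_
    have hc := hB.one_le
    have hq0 : (0 : ℝ) < denominator P := by exact_mod_cast hA.denominator_spec.1
    gcongr
    norm_num

/-- With gaps at least `h` the divided difference of `f - P` is at most `(k+1)δ/h^k`, but it is at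
least `lam / k!`. -/
theorem IsMajorArc.gap_pow_le (hB : Bounds k N f lam c)
    (hA : IsMajorArc k f N δ A P)
    {U : Finset ℤ} (hUA : U ⊆ A) (hU : U.card = k + 1) {h : ℝ} (hh : 0 < h)
    (hgap : ∀ a ∈ U, ∀ b ∈ U, a ≠ b → h ≤ |(a : ℝ) - b|) :
    h ^ k ≤ (k + 1).factorial * (δ / lam) := by
  have hlam := hB.lam_le (r := h ^ k) hA.degree_lt hU
    (fun n hn => mem_Icc_of_mem_S (hA.mem_S (hUA hn)))
    (fun n hn => hA.abs_sub_le (hUA hn)) (by positivity) (by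
      intro i hi
      have : k = (U.erase i).card := by rw [Finset.card_erase_of_mem hi, hU]; rfl
      rw [this, ← Finset.prod_const]
      refine Finset.prod_le_prod (fun _ _ => hh.le) fun j hj => ?_
      exact hgap i hi j (Finset.mem_of_mem_erase hj) (Finset.ne_of_mem_erase hj).symm)
  have hl := hB.lam_pos
  rw [div_le_div_iff₀ (by positivity) (by positivity)] at hlam
  rw [← mul_div_assoc, le_div_iff₀ hl, Nat.factorial_succ]
  push_cast
  linarith

end

/-! ### Exponents and numerical constants -/

theorem two_div_eq_inv {k : ℕ} (hk : 3 ≤ k) :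
    (2 : ℝ) / ((k : ℝ) * ((k : ℝ) - 1)) = ((k * (k - 1) / 2 : ℕ) : ℝ)⁻¹ := by
  have h : (((k * (k - 1) / 2 : ℕ) : ℝ)) * 2 = (k : ℝ) * ((k : ℝ) - 1) := by
    have h1 : k * (k - 1) / 2 * 2 = k * (k - 1) :=
      Nat.div_mul_cancel (Nat.even_mul_pred_self k).two_dvd
    have h2 : ((k * (k - 1) : ℕ) : ℝ) = (k : ℝ) * ((k : ℝ) - 1) := by
      rw [Nat.cast_mul, Nat.cast_sub (by omega)]; simp
    rw [← h2]; exact_mod_cast h1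
  rw [← h, mul_comm, div_mul_eq_div_div, div_self two_ne_zero, one_div]

theorem le_choose_two {k : ℕ} (hk : 3 ≤ k) : k ≤ k * (k - 1) / 2 := by
  rw [Nat.le_div_iff_mul_le two_pos]
  exact Nat.mul_le_mul_left k (by omega)

theorem factorial_succ_le_pow {k : ℕ} (hk : 3 ≤ k) : (k + 1).factorial ≤ k ^ k := by
  induction k, hk using Nat.le_induction with
  | base => decide
  | succ k hk ih =>
    obtain ⟨m, rfl⟩ : ∃ m, k = m + 1 := ⟨k - 1, by omega⟩
    have h1 : (m + 1) ^ m ≤ (m + 2) ^ m := Nat.pow_le_pow_left (by omega) m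
    calc (m + 1 + 1 + 1).factorial = (m + 3) * (m + 1 + 1).factorial := Nat.factorial_succ _
      _ ≤ (m + 3) * (m + 1) ^ (m + 1) := Nat.mul_le_mul_left _ ih
      _ = ((m + 3) * (m + 1)) * (m + 1) ^ m := by ring
      _ ≤ ((m + 2) * (m + 2)) * (m + 2) ^ m := Nat.mul_le_mul (by nlinarith) h1
      _ = (m + 1 + 1) ^ (m + 1 + 1) := by ring

theorem six_mul_succ_le_pow {k : ℕ} (hk : 3 ≤ k) : 6 * (k + 1) ≤ 3 ^ k := by
  induction k, hk using Nat.le_induction with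
  | base => decide
  | succ k hk ih => rw [pow_succ]; omega

/-! ### Isolation of long arcs -/

section

variable {k N : ℕ} {f : ℝ → ℝ} {lam c δ : ℝ} {A : Finset ℤ} {P : ℚ[X]}

/-- `k` successive points of a major arc of denominator `q` span at least `q^{2/(k(k-1))}`. -/
theorem IsMajorArc.rpow_denominator_le (hk : 3 ≤ k) (hA : IsMajorArc k f N δ A P) (a : ℕ)
    (ha : a + (k - 1) < A.card) :
    (denominator P : ℝ) ^ ((k * (k - 1) / 2 : ℕ) : ℝ)⁻¹ ≤
      A.orderEmbOfFin rfl ⟨a + (k - 1), ha⟩ - A.orderEmbOfFin rfl ⟨a, by omega⟩ := by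
  set e := A.orderEmbOfFin rfl with he
  let g : Fin k → ℤ := fun i => e ⟨a + i, by have := i.2; omega⟩
  have hg : Function.Injective g := by
    intro i j hij
    have := e.injective hij
    simp only [Fin.mk.injEq] at this
    exact Fin.ext (by omega)
  have hgA : ∀ i, g i ∈ A := fun i => A.orderEmbOfFin_mem rfl _
  have hlo : ∀ i, e ⟨a, by omega⟩ ≤ g i := fun i => e.monotone (by simp [Fin.le_def])
  have hhi : ∀ i, g i ≤ e ⟨a + (k - 1), ha⟩ := fun i => e.monotone (by
    have := i.2
    simp only [Fin.le_def]; omega)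
  set M := e ⟨a + (k - 1), ha⟩ - e ⟨a, by omega⟩ with hM
  have hM0 : 0 ≤ M := sub_nonneg.2 (e.monotone (by simp [Fin.le_def]))
  have hcard : (Finset.univ.map ⟨g, hg⟩).card = k := by simp
  have h := denominator_le_pow (P := P) (T := Finset.univ.map ⟨g, hg⟩) (M := M.natAbs)
    (by rw [hcard]; exact hA.degree_lt)
    (by
      intro n hn
      obtain ⟨i, -, rfl⟩ := Finset.mem_map.1 hn
      exact hA.liesOn.exists_int _ (hgA i))
    (by
      intro x hx y hy
      obtain ⟨i, -, rfl⟩ := Finset.mem_map.1 hx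
      obtain ⟨j, -, rfl⟩ := Finset.mem_map.1 hy
      have h1 := hlo i
      have h2 := hlo j
      have h3 := hhi i
      have h4 := hhi j
      simp only [Function.Embedding.coeFn_mk]
      omega)
  rw [hcard] at h
  have hMR : ((M.natAbs : ℕ) : ℝ) = (M : ℝ) := by
    rw [Nat.cast_natAbs, abs_of_nonneg hM0]
  have hn0 : k * (k - 1) / 2 ≠ 0 := by have := le_choose_two hk; omega
  calc (denominator P : ℝ) ^ ((k * (k - 1) / 2 : ℕ) : ℝ)⁻¹
      ≤ (((M.natAbs : ℕ) : ℝ) ^ (k * (k - 1) / 2)) ^ ((k * (k - 1) / 2 : ℕ) : ℝ)⁻¹ := by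
        refine Real.rpow_le_rpow (by positivity) ?_ (by positivity)
        exact_mod_cast h
    _ = (M : ℝ) := by rw [Real.pow_rpow_inv_natCast (by positivity) hn0, hMR]
    _ = _ := by rw [hM]; push_cast; rfl

theorem IsMajorArc.mul_rpow_denominator_le (hk : 3 ≤ k) (hA : IsMajorArc k f N δ A P) (s a : ℕ)
    (ha : a + s * (k - 1) < A.card) :
    (s : ℝ) * (denominator P : ℝ) ^ ((k * (k - 1) / 2 : ℕ) : ℝ)⁻¹ ≤
      A.orderEmbOfFin rfl ⟨a + s * (k - 1), ha⟩ -
        A.orderEmbOfFin rfl ⟨a, (Nat.le_add_right _ _).trans_lt ha⟩ := by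
  induction s with
  | zero => simp
  | succ s ih =>
    have hs : a + s * (k - 1) + (k - 1) = a + (s + 1) * (k - 1) := by ring
    have h1 := ih (by omega)
    have h2 := hA.rpow_denominator_le hk (a + s * (k - 1)) (by omega)
    have h3 : (⟨a + s * (k - 1) + (k - 1), by omega⟩ : Fin A.card) =
        ⟨a + (s + 1) * (k - 1), ha⟩ := Fin.ext hs
    rw [h3] at h2
    push_cast
    linarith

/-- A long major arc of small denominator is alone in a long interval. -/
theorem IsMajorArc.exists_isolated (hB : Bounds k N f lam c) (hk : 3 ≤ k) (hδ : 0 < δ)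
    (hA : IsMajorArc k f N δ A P) (hq : 6 * c * (k + 1) * δ * denominator P ≤ 1)
    (hcard : 2 * k ^ 2 < A.card) :
    ∃ u ∈ A, ∃ D : ℝ, (A.filter (· ≤ u)).card = k ∧
      (∀ x ∈ S f N δ, u ≤ x → (x : ℝ) ≤ u + D → x ∈ A) ∧
      (A.card : ℝ) ≤
        2 * k ^ 2 * (6 * c * (k + 1) * δ) ^ ((k * (k - 1) / 2 : ℕ) : ℝ)⁻¹ * D ∧
      (A.card : ℝ) ≤ 2 * k ^ 3 * (δ / lam) ^ ((1 : ℝ) / k) := by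
  classical
  have hc := hB.one_le
  have hc0 : 0 < c := by linarith
  have hlam := hB.lam_pos
  have hq1 : (1 : ℝ) ≤ denominator P := by exact_mod_cast hA.denominator_spec.1
  have hq0 : (0 : ℝ) < denominator P := by linarith
  have hk0 : (0 : ℝ) < k := by exact_mod_cast (by omega : 0 < k)
  set Y := 6 * c * (k + 1) * δ with hYdef
  have hY : 0 < Y := by positivity
  set n := k * (k - 1) / 2 with hn
  have hkn : k ≤ n := le_choose_two hk
  have hn0 : (0 : ℝ) < n := by exact_mod_cast (by omega : 0 < n)
  -- The largest `s` for which `k + 1` points at index step `s * (k - 1)`, starting at index `k -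
  -- 1`, fit in `A`.
  set s := (A.card - k) / (k * (k - 1)) with hs
  have hkk : 0 < k * (k - 1) := Nat.mul_pos (by omega) (by omega)
  have hkk' : k * (k - 1) + k = k ^ 2 := by
    obtain ⟨m, rfl⟩ : ∃ m, k = m + 1 := ⟨k - 1, by omega⟩
    simp only [Nat.add_sub_cancel]; ring
  have hs1 : 1 ≤ s := by
    rw [hs, Nat.le_div_iff_mul_le hkk]
    omega
  have hsm : s * (k * (k - 1)) ≤ A.card - k := Nat.div_mul_le_self _ _
  have hms : A.card ≤ 2 * k ^ 2 * s := by
    have h1 : A.card - k < k * (k - 1) * (s + 1) := Nat.lt_mul_div_succ _ hkk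
    have h2 : k * (k - 1) * (s + 1) = k * (k - 1) * s + k * (k - 1) := by ring
    have h3 : 2 * k ^ 2 * s = 2 * (k * (k - 1) * s) + 2 * (k * s) := by rw [← hkk']; ring
    have h4 : k * (k - 1) ≤ k * (k - 1) * s := Nat.le_mul_of_pos_right _ hs1
    have h5 : k ≤ k * s := Nat.le_mul_of_pos_right _ hs1
    omega
  set w : ℝ := (denominator P : ℝ) ^ ((n : ℕ) : ℝ)⁻¹ with hw
  have hw1 : 1 ≤ w := Real.one_le_rpow hq1 (by positivity)
  set h : ℝ := s * w with hh
  have hs1R : (1 : ℝ) ≤ s := by exact_mod_cast hs1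
  have hh0 : 0 < h := by positivity
  have hidx : ∀ i : Fin (k + 1), (k - 1) + i * (s * (k - 1)) < A.card := by
    intro i
    have h1 : (i : ℕ) * (s * (k - 1)) ≤ k * (s * (k - 1)) :=
      Nat.mul_le_mul_right _ (by have := i.2; omega)
    have h2 : k * (s * (k - 1)) = s * (k * (k - 1)) := by ring
    omega
  set e := A.orderEmbOfFin rfl with he
  let g : Fin (k + 1) → ℤ := fun i => e ⟨(k - 1) + i * (s * (k - 1)), hidx i⟩
  have hgA : ∀ i, g i ∈ A := fun i => A.orderEmbOfFin_mem rfl _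
  have hglt : ∀ i j : Fin (k + 1), i < j → h ≤ (g j : ℝ) - g i := by
    intro i j hij
    have h0 : (k - 1) + (i : ℕ) * (s * (k - 1)) + s * (k - 1) ≤ (k - 1) + j * (s * (k - 1)) := by
      have : ((i : ℕ) + 1) * (s * (k - 1)) ≤ j * (s * (k - 1)) := Nat.mul_le_mul_right _ hij
      rw [add_mul, one_mul] at this
      omega
    have h1 := hA.mul_rpow_denominator_le hk s ((k - 1) + i * (s * (k - 1)))
      (h0.trans_lt (hidx j))
    have h2 : e ⟨_, h0.trans_lt (hidx j)⟩ ≤ g j := e.monotone h0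
    have h2' : ((e ⟨_, h0.trans_lt (hidx j)⟩ : ℤ) : ℝ) ≤ g j := by exact_mod_cast h2
    exact h1.trans (by linarith)
  have hgapij : ∀ i j : Fin (k + 1), i ≠ j → h ≤ |(g i : ℝ) - g j| := by
    intro i j hij
    rcases lt_or_gt_of_ne hij with hlt | hlt
    · rw [abs_sub_comm]; exact (hglt i j hlt).trans (le_abs_self _)
    · exact (hglt j i hlt).trans (le_abs_self _)
  have hginj : Function.Injective g := by
    intro i j hij
    by_contra hne
    have := hgapij i j hne
    rw [hij, sub_self, abs_zero] at this
    linarith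
  set U : Finset ℤ := Finset.univ.map ⟨g, hginj⟩ with hU
  have hUcard : U.card = k + 1 := by simp [hU]
  have hUmem : ∀ x ∈ U, ∃ i, g i = x := by
    intro x hx
    obtain ⟨i, -, rfl⟩ := Finset.mem_map.1 hx
    exact ⟨i, rfl⟩
  have hUA : U ⊆ A := by
    intro x hx
    obtain ⟨i, rfl⟩ := hUmem x hx
    exact hgA i
  have hgap : ∀ a ∈ U, ∀ b ∈ U, a ≠ b → h ≤ |(a : ℝ) - b| := by
    intro a ha b hb hab
    obtain ⟨i, rfl⟩ := hUmem a ha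
    obtain ⟨j, rfl⟩ := hUmem b hb
    exact hgapij i j fun hij => hab (by rw [hij])
  set z : ℝ := (Y * denominator P) ^ (-((k : ℝ)⁻¹)) with hz
  have hYq0 : 0 < Y * denominator P := by positivity
  have hz1 : 1 ≤ z := Real.one_le_rpow_of_pos_of_le_one_of_nonpos hYq0 hq
    (neg_nonpos.2 (by positivity))
  have hhD : h ≤ h * z := le_mul_of_one_le_right hh0.le hz1
  have hzk : z ^ k = 1 / (Y * denominator P) := by
    rw [hz, Real.rpow_neg hYq0.le, inv_pow, Real.rpow_inv_natCast_pow hYq0.le (by omega), one_div]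
  have hDk : (h * z / h) ^ k ≤ 1 / (Y * denominator P) := by
    rw [mul_div_cancel_left₀ _ hh0.ne', hzk]
  have hi0 : k - 1 < A.card := by have := hA.card_ge; omega
  -- Starting at the `k`-th point leaves `k` points of `A` up to `u`, enough to identify the arc.
  set u : ℤ := e ⟨k - 1, hi0⟩ with hu
  have huA : u ∈ A := A.orderEmbOfFin_mem rfl _
  have hug : ∀ i, u ≤ g i := fun i => e.monotone (by simp [Fin.le_def])
  refine ⟨u, huA, h * z, ?_, ?_, ?_, ?_⟩
  · have hset : A.filter (· ≤ u) =
        (Finset.univ.filter fun i : Fin A.card => i ≤ ⟨k - 1, hi0⟩).map e.toEmbedding := by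
      ext x
      simp only [Finset.mem_filter, Finset.mem_map, Finset.mem_univ, true_and]
      constructor
      · rintro ⟨hxA, hxu⟩
        obtain ⟨i, rfl⟩ : ∃ i, e i = x := by
          have : x ∈ Set.range e := by rw [he, Finset.range_orderEmbOfFin]; exact hxA
          exact this
        exact ⟨i, e.le_iff_le.1 hxu, rfl⟩
      · rintro ⟨i, hi, rfl⟩
        exact ⟨A.orderEmbOfFin_mem rfl i, e.monotone hi⟩
    rw [hset, Finset.card_map]
    have : (Finset.univ.filter fun i : Fin A.card => i ≤ ⟨k - 1, hi0⟩) =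
        Finset.Iic ⟨k - 1, hi0⟩ := by ext; simp
    rw [this, Fin.card_Iic]
    simp only
    omega
  · intro x hx hux hxD
    -- If `A` reaches beyond the interval, consecutiveness suffices; if not, all of `U` is within
    -- `D` of every point of it.
    by_cases hAD : ∀ y ∈ A, (y : ℝ) ≤ u + h * z
    · refine hA.subset_of_gaps hB hk hδ hq hUA hUcard hh0 hgap hhD hDk
        (W := (S f N δ).filter fun y => u ≤ y ∧ (y : ℝ) ≤ u + h * z) ?_ ?_ huA ?_
        (Finset.mem_filter.2 ⟨hx, hux, hxD⟩)
      · refine ⟨Finset.filter_subset _ _, fun a ha b hb y hy hay hyb => ?_⟩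
        obtain ⟨-, ha1, -⟩ := Finset.mem_filter.1 ha
        obtain ⟨-, -, hb2⟩ := Finset.mem_filter.1 hb
        refine Finset.mem_filter.2 ⟨hy, ha1.trans hay, le_trans ?_ hb2⟩
        exact_mod_cast hyb
      · intro y hy j hj
        obtain ⟨-, hy1, hy2⟩ := Finset.mem_filter.1 hy
        obtain ⟨i, rfl⟩ := hUmem j hj
        have h1 : (u : ℝ) ≤ g i := by exact_mod_cast hug i
        have h2 := hAD _ (hgA i)
        have h3 : (u : ℝ) ≤ y := by exact_mod_cast hy1
        rw [abs_le]
        constructor <;> linarith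
      · refine Finset.mem_filter.2 ⟨hA.mem_S huA, le_rfl, ?_⟩
        have : 0 < h * z := by positivity
        linarith
    · push Not at hAD
      obtain ⟨y, hyA, hy⟩ := hAD
      refine hA.consecutive.2 u huA y hyA x hx hux ?_
      exact_mod_cast hxD.trans hy.le
  -- The right side is `s (Yq)^(1/n - 1/k)`, with `Yq ≤ 1` and `1/n ≤ 1/k`.
  · have h1 : (s : ℝ) ≤ Y ^ ((n : ℕ) : ℝ)⁻¹ * (h * z) := by
      have h2 : Y ^ ((n : ℕ) : ℝ)⁻¹ * (h * z) =
          s * (Y * denominator P) ^ ((n : ℝ)⁻¹ + -((k : ℝ)⁻¹)) := by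
        rw [Real.rpow_add hYq0, Real.mul_rpow hY.le hq0.le, ← hw, ← hz, hh]; ring
      rw [h2]
      refine le_mul_of_one_le_right (by positivity)
        (Real.one_le_rpow_of_pos_of_le_one_of_nonpos hYq0 hq ?_)
      have : (n : ℝ)⁻¹ ≤ (k : ℝ)⁻¹ := inv_anti₀ hk0 (by exact_mod_cast hkn)
      linarith
    calc (A.card : ℝ) ≤ 2 * k ^ 2 * s := by exact_mod_cast hms
      _ ≤ 2 * k ^ 2 * (Y ^ ((n : ℕ) : ℝ)⁻¹ * (h * z)) := by gcongr
      _ = _ := by ring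
  · have h1 := hA.gap_pow_le hB hUA hUcard hh0 hgap
    have h2 : h ^ k ≤ (k : ℝ) ^ k * (δ / lam) := h1.trans (by
      gcongr
      exact_mod_cast factorial_succ_le_pow hk)
    have h3 : h ≤ k * (δ / lam) ^ ((1 : ℝ) / k) := by
      refine le_of_pow_le_pow_left₀ (by omega : k ≠ 0) (by positivity) ?_
      rw [mul_pow (k : ℝ), one_div, Real.rpow_inv_natCast_pow (by positivity) (by omega)]
      exact h2
    calc (A.card : ℝ) ≤ 2 * k ^ 2 * s := by exact_mod_cast hms
      _ ≤ 2 * k ^ 2 * h := by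
          gcongr
          exact le_mul_of_one_le_right (by positivity) hw1
      _ ≤ 2 * k ^ 2 * (k * (δ / lam) ^ ((1 : ℝ) / k)) := by gcongr
      _ = _ := by ring

/-- If `A` starts no later than `A'`, it contains the `k` points of `A'` up to `u'`; otherwise `A'`
contains the `k` points of `A` up to `u`. -/
theorem IsMajorArc.eq_of_mem (hk : 0 < k) {A' : Finset ℤ} {P' : ℚ[X]}
    (hA : IsMajorArc k f N δ A P) (hA' : IsMajorArc k f N δ A' P') {u u' : ℤ}
    (hu' : u' ∈ A') (hcard : (A.filter (· ≤ u)).card = k) (hcard' : (A'.filter (· ≤ u')).card = k)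
    (huu : u ≤ u') (hmem : u' ∈ A) : A = A' := by
  classical
  have hne : A'.Nonempty := ⟨u', hu'⟩
  refine hA.eq_of_card_inter hk hA' ?_
  by_cases h : ∃ a ∈ A, a ≤ A'.min' hne
  · obtain ⟨a, ha, ha'⟩ := h
    rw [← hcard']
    refine Finset.card_le_card fun x hx => ?_
    obtain ⟨hx1, hx2⟩ := Finset.mem_filter.1 hx
    exact Finset.mem_inter.2 ⟨hA.consecutive.2 a ha u' hmem x (hA'.mem_S hx1)
      (ha'.trans (A'.min'_le x hx1)) hx2, hx1⟩
  · push Not at h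
    rw [← hcard]
    refine Finset.card_le_card fun x hx => ?_
    obtain ⟨hx1, hx2⟩ := Finset.mem_filter.1 hx
    exact Finset.mem_inter.2 ⟨hx1, hA'.consecutive.2 _ (A'.min'_mem hne) u' hu' x (hA.mem_S hx1)
      (h x hx1).le (hx2.trans huu)⟩

end

/-! ### Packing and the final count -/

theorem sum_le_of_separated {ι : Type*} (t : Finset ι) (u D w : ι → ℝ) {μ a : ℝ} (hμ : 0 ≤ μ)
    (hw : ∀ i ∈ t, w i ≤ μ * D i) (hsep : ∀ i ∈ t, ∀ j ∈ t, i ≠ j → u i ≤ u j → u i + D i ≤ u j)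
    (ha : ∀ i ∈ t, a ≤ u i) : ∀ Z, a ≤ Z → (∀ i ∈ t, u i + D i ≤ Z) →
      ∑ i ∈ t, w i ≤ μ * (Z - a) := by
  classical
  induction t using Finset.induction_on_max_value u with
  | empty =>
    intro Z hZ _
    simpa using mul_nonneg hμ (sub_nonneg.2 hZ)
  | insert i t hi hmax ih =>
    intro Z hZ hle
    have hii := Finset.mem_insert_self i t
    have hit : ∀ j ∈ t, j ∈ insert i t := fun j hj => Finset.mem_insert_of_mem hj
    have h1 := ih (fun j hj => hw j (hit j hj))
      (fun j hj l hl => hsep j (hit j hj) l (hit l hl)) (fun j hj => ha j (hit j hj)) (u i)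
      (ha i hii) fun j hj =>
        hsep j (hit j hj) i hii (by rintro rfl; exact hi hj) (hmax j hj)
    rw [Finset.sum_insert hi]
    have h2 := hw i hii
    have h3 : μ * (u i + D i) ≤ μ * Z := mul_le_mul_of_nonneg_left (hle i hii) hμ
    linarith

/-- All intervals but the rightmost end before `b`; that one may overshoot, so its weight is charged
to `ν`. -/
theorem sum_le_of_separated_add {ι : Type*} (t : Finset ι) (u D w : ι → ℝ) {μ ν a b : ℝ}
    (hμ : 0 ≤ μ) (hν : 0 ≤ ν) (hab : a ≤ b) (hw : ∀ i ∈ t, w i ≤ μ * D i)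
    (hwν : ∀ i ∈ t, w i ≤ ν)
    (hsep : ∀ i ∈ t, ∀ j ∈ t, i ≠ j → u i ≤ u j → u i + D i ≤ u j)
    (ha : ∀ i ∈ t, a ≤ u i) (hb : ∀ i ∈ t, u i ≤ b) :
    ∑ i ∈ t, w i ≤ μ * (b - a) + ν := by
  classical
  rcases t.eq_empty_or_nonempty with rfl | hne
  · simpa using add_nonneg (mul_nonneg hμ (sub_nonneg.2 hab)) hν
  obtain ⟨i, hi, hmax⟩ := Finset.exists_max_image t u hne
  rw [← Finset.sum_erase_add t w hi]
  have he : ∀ j ∈ t.erase i, j ∈ t := fun j hj => Finset.mem_of_mem_erase hj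
  have h1 := sum_le_of_separated (t.erase i) u D w hμ (fun j hj => hw j (he j hj))
    (fun j hj l hl => hsep j (he j hj) l (he l hl)) (fun j hj => ha j (he j hj)) (u i) (ha i hi)
    fun j hj => hsep j (he j hj) i hi (Finset.ne_of_mem_erase hj) (hmax j (he j hj))
  have h2 := mul_le_mul_of_nonneg_left (sub_le_sub_right (hb i hi) a) hμ
  linarith [hwν i hi]

section

variable {k N : ℕ} {f : ℝ → ℝ} {lam c δ : ℝ}

theorem isConsecutive_fiber {φ : ℤ → ℕ} (hφ : Monotone φ) (j : ℕ) :
    IsConsecutive f N δ ((S f N δ).filter fun n => φ n = j) := by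
  refine ⟨Finset.filter_subset _ _, fun a ha b hb n hn han hnb => ?_⟩
  have h1 := (Finset.mem_filter.1 ha).2
  have h2 := (Finset.mem_filter.1 hb).2
  exact Finset.mem_filter.2 ⟨hn, le_antisymm (h2 ▸ hφ hnb) (h1 ▸ hφ han)⟩

/-- If every major arc has at most `k` points in a window, the arcs together have at most `2k`. -/
theorem card_fiber_le {φ : ℤ → ℕ} (hφ : Monotone φ) (j : ℕ)
    (harc : ∀ A P, IsMajorArc k f N δ A P →
      (A ∩ (S f N δ).filter fun n => φ n = j).card ≤ k)
    {V : Finset ℤ} (hV : ∀ n ∈ V, φ n = j ∧ ∃ A P, IsMajorArc k f N δ A P ∧ n ∈ A) :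
    V.card ≤ 2 * k := by
  classical
  set W := (S f N δ).filter fun n => φ n = j with hW
  -- The arc through the largest point of `L` that comes from an earlier window contains all of `L`;
  -- symmetrically for `R`.
  set L := W.filter fun n => ∃ A P, IsMajorArc k f N δ A P ∧ n ∈ A ∧ ∃ y ∈ A, φ y < j with hL
  set R := W.filter fun n => ∃ A P, IsMajorArc k f N δ A P ∧ n ∈ A ∧ ∃ y ∈ A, j < φ y with hR
  have hLk : L.card ≤ k := by
    rcases L.eq_empty_or_nonempty with h | hne
    · simp [h]
    obtain ⟨hpW, A, P, hA, hpA, y, hyA, hy⟩ := Finset.mem_filter.1 (L.max'_mem hne)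
    refine (Finset.card_le_card fun x hx => ?_).trans (harc A P hA)
    have hxW := (Finset.mem_filter.1 hx).1
    obtain ⟨hxS, hxj⟩ := Finset.mem_filter.1 hxW
    refine Finset.mem_inter.2 ⟨hA.consecutive.2 y hyA _ hpA x hxS ?_ (L.le_max' x hx), hxW⟩
    by_contra hlt
    have := hφ (not_le.1 hlt).le
    omega
  have hRk : R.card ≤ k := by
    rcases R.eq_empty_or_nonempty with h | hne
    · simp [h]
    obtain ⟨hpW, A, P, hA, hpA, y, hyA, hy⟩ := Finset.mem_filter.1 (R.min'_mem hne)
    refine (Finset.card_le_card fun x hx => ?_).trans (harc A P hA)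
    have hxW := (Finset.mem_filter.1 hx).1
    obtain ⟨hxS, hxj⟩ := Finset.mem_filter.1 hxW
    refine Finset.mem_inter.2 ⟨hA.consecutive.2 _ hpA y hyA x hxS (R.min'_le x hx) ?_, hxW⟩
    by_contra hlt
    have := hφ (not_le.1 hlt).le
    omega
  have hsub : V ⊆ L ∪ R := by
    intro n hn
    obtain ⟨hnj, A, P, hA, hnA⟩ := hV n hn
    have hnW : n ∈ W := Finset.mem_filter.2 ⟨hA.mem_S hnA, hnj⟩
    obtain ⟨y, hyA, hy⟩ : ∃ y ∈ A, φ y ≠ j := by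
      by_contra! h
      have hAW : A ∩ W = A := Finset.inter_eq_left.2 fun y hy =>
        Finset.mem_filter.2 ⟨hA.mem_S hy, h y hy⟩
      have h1 := harc A P hA
      rw [hAW] at h1
      have h2 := hA.card_ge
      omega
    rcases lt_or_gt_of_ne hy with h | h
    · exact Finset.mem_union_left _ (Finset.mem_filter.2 ⟨hnW, A, P, hA, hnA, y, hyA, h⟩)
    · exact Finset.mem_union_right _ (Finset.mem_filter.2 ⟨hnW, A, P, hA, hnA, y, hyA, h⟩)
  have h1 := Finset.card_le_card hsub
  have h2 := Finset.card_union_le L R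
  omega

theorem Bounds.R₀_le (hB : Bounds k N f lam c) (hk : 3 ≤ k) (hδ : 0 < δ) :
    (R₀ k f N δ : ℝ) ≤
      4 * k ^ 2 * (6 * c * (k + 1) * δ) ^ ((k * (k - 1) / 2 : ℕ) : ℝ)⁻¹ * N
        + 2 * k ^ 2 + 2 * k ^ 3 * (δ / lam) ^ ((1 : ℝ) / k) := by
  classical
  have hc := hB.one_le
  have hc0 : 0 < c := by linarith
  have hlam := hB.lam_pos
  have hN : (0 : ℝ) < N := by exact_mod_cast hB.pos
  set Y := 6 * c * (k + 1) * δ with hYdef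
  have hY : 0 < Y := by positivity
  set n := k * (k - 1) / 2 with hn
  have hkn : k ≤ n := le_choose_two hk
  -- Windows have length `1/y`, so that `(1/y)^n * Y = 1` as `IsMajorArc.window_subset` requires.
  set y := Y ^ ((n : ℕ) : ℝ)⁻¹ with hy
  have hy0 : 0 < y := by positivity
  have hyn : y ^ n = Y := Real.rpow_inv_natCast_pow hY.le (by omega)
  set V₀ : Finset ℤ := (S f N δ).filter fun n : ℤ =>
    ∃ (A : Finset ℤ) (P : ℚ[X]), IsMajorArc k f N δ A P ∧ n ∈ A with hV₀
  have hR : R₀ k f N δ = V₀.card := by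
    unfold R₀
    congr 1
  set t : Finset (Finset ℤ) := (S f N δ).powerset.filter fun A =>
    ∃ P, IsMajorArc k f N δ A P ∧ Y * denominator P ≤ 1 ∧ 2 * k ^ 2 < A.card with ht
  have hlong : ∀ A : Finset ℤ, A ∈ t → ∃ u ∈ A, ∃ D : ℝ, (A.filter (· ≤ u)).card = k ∧
      (∀ x ∈ S f N δ, u ≤ x → (x : ℝ) ≤ u + D → x ∈ A) ∧
      (A.card : ℝ) ≤ 2 * k ^ 2 * y * D ∧
      (A.card : ℝ) ≤ 2 * k ^ 3 * (δ / lam) ^ ((1 : ℝ) / k) := by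
    intro A hA
    obtain ⟨-, P, hAP, hq, hcard⟩ := Finset.mem_filter.1 hA
    exact hAP.exists_isolated hB hk hδ hq hcard
  choose! u hu D hcount hiso hw hwν using hlong
  have hsum : (∑ A ∈ t, (A.card : ℝ)) ≤ 2 * k ^ 2 * y * (2 * (N : ℝ) - N) +
      2 * k ^ 3 * (δ / lam) ^ ((1 : ℝ) / k) := by
    refine sum_le_of_separated_add t (fun A => (u A : ℝ)) D (fun A => (A.card : ℝ)) (by positivity)
      (by positivity) (by linarith) hw hwν ?_ ?_ ?_
    · intro A hA B hB' hAB hle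
      obtain ⟨-, P, hAP, -⟩ := Finset.mem_filter.1 hA
      obtain ⟨-, Q, hBQ, -⟩ := Finset.mem_filter.1 hB'
      by_contra! hlt
      have hle' : u A ≤ u B := by exact_mod_cast hle
      exact hAB (hAP.eq_of_mem (by omega) hBQ (hu B hB') (hcount A hA) (hcount B hB') hle'
        (hiso A hA _ (hBQ.mem_S (hu B hB')) hle' hlt.le))
    · intro A hA
      obtain ⟨-, P, hAP, -⟩ := Finset.mem_filter.1 hA
      exact (mem_Icc_of_mem_S (hAP.mem_S (hu A hA))).1
    · intro A hA
      obtain ⟨-, P, hAP, -⟩ := Finset.mem_filter.1 hA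
      exact (mem_Icc_of_mem_S (hAP.mem_S (hu A hA))).2
  set φ : ℤ → ℕ := fun m => ⌊((m : ℝ) - N) * y⌋₊ with hφ
  have hmono : Monotone φ := by
    intro a b hab
    refine Nat.floor_mono ?_
    have : (a : ℝ) ≤ b := by exact_mod_cast hab
    gcongr
  -- Once the long arcs of `t` are removed, a window is either empty, inside one arc of at most
  -- `2k²` points, or met by every arc in at most `k` points.
  have hfib : ∀ j ∈ Finset.range (⌊(N : ℝ) * y⌋₊ + 1),
      ((V₀ \ t.biUnion id).filter fun m => φ m = j).card ≤ 2 * k ^ 2 := by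
    intro j _
    set W := (S f N δ).filter fun m => φ m = j with hW
    have h2k : 2 * k ≤ 2 * k ^ 2 := by nlinarith
    by_cases hex : ∃ A P, IsMajorArc k f N δ A P ∧ k + 1 ≤ (A ∩ W).card
    · obtain ⟨A, P, hA, hcard⟩ := hex
      obtain ⟨hWA, hq⟩ := hA.window_subset hB hk hδ (X := 1 / y)
        (by rw [← hYdef, ← hn, ← hyn, div_pow, one_pow, one_div, inv_mul_cancel₀ (by positivity)])
        (isConsecutive_fiber hmono j) (by
          intro a ha b hb
          have key : ∀ m ∈ W, (j : ℝ) ≤ ((m : ℝ) - N) * y ∧ ((m : ℝ) - N) * y < j + 1 := by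
            intro m hm
            obtain ⟨hmS, hmj⟩ := Finset.mem_filter.1 hm
            have h0 : 0 ≤ ((m : ℝ) - N) * y :=
              mul_nonneg (sub_nonneg.2 (mem_Icc_of_mem_S hmS).1) hy0.le
            exact (Nat.floor_eq_iff h0).1 hmj
          obtain ⟨ha1, ha2⟩ := key a ha
          obtain ⟨hb1, hb2⟩ := key b hb
          have habs : |(a : ℝ) - b| * y = |((a : ℝ) - b) * y| := by rw [abs_mul, abs_of_pos hy0]
          rw [le_div_iff₀ hy0, habs, abs_le]
          constructor <;> linarith)
        hcard
      by_cases hbig : 2 * k ^ 2 < A.card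
      · have hAt : A ∈ t := Finset.mem_filter.2
          ⟨Finset.mem_powerset.2 hA.consecutive.1, P, hA, hq, hbig⟩
        rw [Finset.card_eq_zero.2]
        · exact Nat.zero_le _
        · refine Finset.filter_eq_empty_iff.2 fun m hm hmj => ?_
          obtain ⟨hm1, hm2⟩ := Finset.mem_sdiff.1 hm
          refine hm2 (Finset.mem_biUnion.2 ⟨A, hAt, hWA ?_⟩)
          exact Finset.mem_filter.2 ⟨(Finset.mem_filter.1 hm1).1, hmj⟩
      · refine (Finset.card_le_card fun m hm => hWA ?_).trans (not_lt.1 hbig)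
        obtain ⟨hm1, hm2⟩ := Finset.mem_filter.1 hm
        exact Finset.mem_filter.2
          ⟨(Finset.mem_filter.1 (Finset.mem_sdiff.1 hm1).1).1, hm2⟩
    · push Not at hex
      refine (card_fiber_le hmono j (fun A P hA => Nat.lt_succ_iff.1 (hex A P hA))
        fun m hm => ?_).trans h2k
      obtain ⟨hm1, hm2⟩ := Finset.mem_filter.1 hm
      exact ⟨hm2, (Finset.mem_filter.1 (Finset.mem_sdiff.1 hm1).1).2⟩
  have hshort := Finset.card_le_mul_card_image_of_maps_to
    (s := V₀ \ t.biUnion id) (t := Finset.range (⌊(N : ℝ) * y⌋₊ + 1)) (f := φ) (by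
      intro m hm
      have hmS := (Finset.mem_filter.1 (Finset.mem_sdiff.1 hm).1).1
      refine Finset.mem_range.2 (Nat.lt_succ_of_le (Nat.floor_mono ?_))
      have := (mem_Icc_of_mem_S hmS).2
      gcongr
      linarith) (2 * k ^ 2) hfib
  rw [Finset.card_range] at hshort
  have hcard : V₀.card ≤ (V₀ \ t.biUnion id).card + (t.biUnion id).card :=
    Finset.card_le_card_sdiff_add_card
  have hbi : (t.biUnion id).card ≤ ∑ A ∈ t, A.card := Finset.card_biUnion_le
  have hfl : (⌊(N : ℝ) * y⌋₊ : ℝ) ≤ N * y := Nat.floor_le (by positivity)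
  rw [hR]
  calc (V₀.card : ℝ) ≤ ((2 * k ^ 2 * (⌊(N : ℝ) * y⌋₊ + 1) + ∑ A ∈ t, A.card : ℕ) : ℝ) := by
        exact_mod_cast hcard.trans (Nat.add_le_add hshort hbi)
    _ = 2 * (k : ℝ) ^ 2 * ((⌊(N : ℝ) * y⌋₊ : ℝ) + 1) + ∑ A ∈ t, (A.card : ℝ) := by push_cast; rfl
    _ ≤ 2 * (k : ℝ) ^ 2 * (N * y + 1) + (2 * k ^ 2 * y * (2 * (N : ℝ) - N) +
      2 * k ^ 3 * (δ / lam) ^ ((1 : ℝ) / k)) := by gcongr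
    _ = _ := by ring

/-- The bound holds whether or not the major arcs have disjoint covers. -/
theorem Bounds.R₀_le_bConst (hB : Bounds k N f lam c) (hk : 3 ≤ k) (hδ : 0 < δ) :
    (R₀ k f N δ : ℝ) ≤
      bConst k c * N * δ ^ ((2 : ℝ) / ((k : ℝ) * ((k : ℝ) - 1)))
        + 8 * (k : ℝ) ^ 3 * (δ / lam) ^ ((1 : ℝ) / (k : ℝ))
        + 10 * Real.exp 3 * (k : ℝ) ^ 2 := by
  have hc := hB.one_le
  have hc0 : 0 < c := by linarith
  have hlam := hB.lam_pos
  have hexp : 1 ≤ Real.exp 3 := Real.one_le_exp (by norm_num)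
  unfold bConst
  rw [two_div_eq_inv hk]
  refine (hB.R₀_le hk hδ).trans ?_
  set n := k * (k - 1) / 2 with hn
  have hkn : k ≤ n := le_choose_two hk
  -- Hence the factor of `N` is at most `12 k² (cδ)^(1/n)`, below the required `20 e³ k²
  -- (cδ)^(1/n)`.
  have h3 : (6 * ((k : ℝ) + 1)) ^ ((n : ℕ) : ℝ)⁻¹ ≤ 3 := by
    have h1 : 6 * ((k : ℝ) + 1) ≤ 3 ^ n := by
      exact_mod_cast (six_mul_succ_le_pow hk).trans (Nat.pow_le_pow_right (by norm_num) hkn)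
    refine (Real.rpow_le_rpow (by positivity) h1 (by positivity)).trans (le_of_eq ?_)
    exact Real.pow_rpow_inv_natCast (by norm_num) (by omega)
  have hsplit : (6 * c * (k + 1) * δ) ^ ((n : ℕ) : ℝ)⁻¹ =
      (6 * ((k : ℝ) + 1)) ^ ((n : ℕ) : ℝ)⁻¹ * (c ^ ((n : ℕ) : ℝ)⁻¹ * δ ^ ((n : ℕ) : ℝ)⁻¹) := by
    rw [← Real.mul_rpow hc0.le hδ.le, ← Real.mul_rpow (by positivity) (by positivity)]
    congr 1; ring
  rw [hsplit]
  have e1 : 4 * (k : ℝ) ^ 2 * ((6 * ((k : ℝ) + 1)) ^ ((n : ℕ) : ℝ)⁻¹ *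
      (c ^ ((n : ℕ) : ℝ)⁻¹ * δ ^ ((n : ℕ) : ℝ)⁻¹)) * N ≤
      20 * Real.exp 3 * (k : ℝ) ^ 2 * c ^ ((n : ℕ) : ℝ)⁻¹ * N * δ ^ ((n : ℕ) : ℝ)⁻¹ := by
    have h0 : 0 ≤ (k : ℝ) ^ 2 * (c ^ ((n : ℕ) : ℝ)⁻¹ * δ ^ ((n : ℕ) : ℝ)⁻¹) * N := by positivity
    calc _ = 4 * (6 * ((k : ℝ) + 1)) ^ ((n : ℕ) : ℝ)⁻¹ *
          ((k : ℝ) ^ 2 * (c ^ ((n : ℕ) : ℝ)⁻¹ * δ ^ ((n : ℕ) : ℝ)⁻¹) * N) := by ring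
      _ ≤ (20 * Real.exp 3) *
          ((k : ℝ) ^ 2 * (c ^ ((n : ℕ) : ℝ)⁻¹ * δ ^ ((n : ℕ) : ℝ)⁻¹) * N) :=
          mul_le_mul_of_nonneg_right (by linarith) h0
      _ = _ := by ring
  have e2 : 2 * (k : ℝ) ^ 2 ≤ 10 * Real.exp 3 * (k : ℝ) ^ 2 := by gcongr; linarith
  have e3 : 2 * (k : ℝ) ^ 3 * (δ / lam) ^ ((1 : ℝ) / (k : ℝ)) ≤
      8 * (k : ℝ) ^ 3 * (δ / lam) ^ ((1 : ℝ) / (k : ℝ)) := by gcongr; norm_num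
  linarith

end

end MajorArcs

theorem lemma8 (k : ℕ) (hk : 3 ≤ k) (N : ℕ) (hN : 4 ≤ N) (δ : ℝ) (hδ : 0 < δ) (hδ' : δ < 1 / 4)
    (f : ℝ → ℝ) (hf : ContDiffOn ℝ k f (Set.Icc (N : ℝ) (2 * (N : ℝ))))
    (lam c : ℝ) (hlam : 0 < lam) (hc : 1 ≤ c)
    (hder : ∀ x ∈ Set.Icc (N : ℝ) (2 * (N : ℝ)),
      lam ≤ |iteratedDerivWithin k f (Set.Icc (N : ℝ) (2 * (N : ℝ))) x| ∧
      |iteratedDerivWithin k f (Set.Icc (N : ℝ) (2 * (N : ℝ))) x| ≤ c * lam)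
    (σ : Finset ℤ → Finset ℤ) (hσ : MajorArcs.IsSelection k f N δ σ) :
    (MajorArcs.HasDisjointCovers k f N δ c σ →
      (MajorArcs.R₀ k f N δ : ℝ) ≤
        MajorArcs.bConst k c * N * δ ^ ((2 : ℝ) / ((k : ℝ) * ((k : ℝ) - 1)))
          + 8 * (k : ℝ) ^ 3 * (δ / lam) ^ ((1 : ℝ) / (k : ℝ))
          + 10 * Real.exp 3 * (k : ℝ) ^ 2) ∧
    (¬ MajorArcs.HasDisjointCovers k f N δ c σ →
      (MajorArcs.R₀ k f N δ : ℝ) ≤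
        3 / 2 * MajorArcs.bConst k c * N * δ ^ ((2 : ℝ) / ((k : ℝ) * ((k : ℝ) - 1)))
          + 16 * (k : ℝ) ^ 3 * (δ / lam) ^ ((1 : ℝ) / (k : ℝ))
          + 10 * Real.exp 3 * (k : ℝ) ^ 2) := by
  have h := MajorArcs.Bounds.R₀_le_bConst (δ := δ)
    ⟨by omega, hf, hlam, hc, fun x hx => (hder x hx).1, fun x hx => (hder x hx).2⟩ hk hδ
  refine ⟨fun _ => h, fun _ => h.trans ?_⟩
  have h1 : 0 ≤ MajorArcs.bConst k c * N * δ ^ ((2 : ℝ) / ((k : ℝ) * ((k : ℝ) - 1))) := by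
    unfold MajorArcs.bConst
    have : 0 ≤ c := by linarith
    positivity
  have h2 : 0 ≤ (k : ℝ) ^ 3 * (δ / lam) ^ ((1 : ℝ) / (k : ℝ)) := by positivity
  linarith
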